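/- Let $\alpha,\beta,\gamma,\delta,\varepsilon,a,B\in\mathbb{C}$ with $a\neq 0,1$ and $\gamma+\delta+\varepsilon=1+\alpha+\beta$, and consider the Heun equation $$\frac{d^2y}{dx^2}+\left(\frac{\gamma}{x}+\frac{\delta}{x-1}+\frac{\varepsilon}{x-a}\right)\frac{dy}{dx}+\frac{\alpha\beta x-\frac{B}{4}}{x(x-1)(x-a)}\,y=0 .$$ Suppose that $$\alpha\notin\{0,\gamma,\delta,\varepsilon,\gamma+\delta,\gamma+\varepsilon,\delta+\varepsilon,\gamma+\delta+\varepsilon\}+\mathbb{Z}.$$ Let $y=(y_1,y_2)^{T}$ be a basis of holomorphic solutions near a base point $b\in X=\mathbb{C}\setminus\{0,1,a\}$. The monodromy matrix of a loop $\ell$ in $X$ based at $b$ is the matrix $M\in\mathrm{GL}(2,\mathbb{C})$ such that analytic continuation of $y$ along $\ell$ yields $My$; let $G\subset\mathrm{GL}(2,\mathbb{C})$ be the monodromy group, i.e. the group of all these matrices. Let $P,Q,R\in G$ be the monodromy matrices of a standard system of loops $\ell_0,\ell_1,\ell_a$ based at $b$: each $\ell_c$ is freely homotopic in $X$ to a small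 positively oriented circle around $c$, the three loops generate $\pi_1(X,b)$, and one of the products $\ell_0\ell_1\ell_a$, $\ell_0\ell_a\ell_1$ is freely homotopic in $X$ to a large positively oriented circle enclosing $0,1,a$. Put $P_0=e^{\pi i\gamma}P$, $Q_0=e^{\pi i\delta}Q$, $R_0=e^{\pi i\varepsilon}R$. Call $G$ unitary if there is a nondegenerate (not necessarily definite) Hermitian matrix $H$ with $g^\dagger Hg=H$ for all $g\in G$. Then $G$ is unitary if and only if both of the following conditions hold: (i) $\gamma,\delta,\varepsilon$ are real, and either $\alpha,\beta\in\mathbb{R}$ or $\alpha-\overline{\beta}\in\mathbb{Z}$; (ii) the traces $\operatorname{tr}(P_0Q_0)$, $\operatorname{tr}(Q_0R_0)$, $\operatorname{tr}(P_0R_0)$ are real. Moreover, if (i) holds, then (ii) is equivalent to the condition that the real algebra generated by $P_0,Q_0,R_0$ has real dimension $4$; hence (ii) may be replaced by this condition in the criterion. -/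

import Mathlib

open scoped Matrix unitInterval Topology

/-- `g` is obtained from `f` by analytic continuation along the path `ℓ` in `ℂ \ S`:
there are functions `F t`, analytic at `ℓ t`, whose germs fit together locally along `ℓ`, start at
the germ of `f` and end at the germ of `g`. -/
def IsAnalyticContinuation {S : Set ℂ} {b c : ↥Sᶜ} (ℓ : Path b c) (f g : ℂ → ℂ) : Prop :=
  ∃ F : I → ℂ → ℂ,
    (∀ t, AnalyticAt ℂ (F t) (ℓ t : ℂ)) ∧
    (∀ t, ∀ᶠ s in 𝓝 t, F s =ᶠ[𝓝 (ℓ s : ℂ)] F t) ∧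
    F 0 =ᶠ[𝓝 (b : ℂ)] f ∧
    F 1 =ᶠ[𝓝 (c : ℂ)] g

/-- `y 0, y 1` are linearly independent holomorphic solutions of `y'' + p y' + q y = 0`
in a neighbourhood of the point `b`. -/
structure IsFundamentalSystem (p q : ℂ → ℂ) (b : ℂ) (y : Fin 2 → ℂ → ℂ) : Prop where
  analytic : ∀ i, AnalyticAt ℂ (y i) b
  solution : ∀ i, ∀ᶠ z in 𝓝 b, deriv (deriv (y i)) z + p z * deriv (y i) z + q z * y i z = 0
  independent : ∀ c : Fin 2 → ℂ, (∀ᶠ z in 𝓝 b, ∑ i, c i * y i z = 0) → c = 0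

/-- `M` is the monodromy matrix of the pair of functions `y` along the loop `ℓ`: the continuation
of the column `y` along `ℓ` is `M y` near the base point. -/
def IsMonodromyMatrix {S : Set ℂ} {b : ↥Sᶜ} (y : Fin 2 → ℂ → ℂ) (ℓ : Path b b)
    (M : GL (Fin 2) ℂ) : Prop :=
  ∀ i, IsAnalyticContinuation ℓ (y i) (fun z => ∑ j, (M : Matrix (Fin 2) (Fin 2) ℂ) i j * y j z)

/-- The group of all monodromy matrices of `y` along loops in `ℂ \ S` based at `b`. -/
def monodromyGroup {S : Set ℂ} (b : ↥Sᶜ) (y : Fin 2 → ℂ → ℂ) : Subgroup (GL (Fin 2) ℂ) :=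
  Subgroup.closure {M | ∃ ℓ : Path b b, IsMonodromyMatrix y ℓ M}

/-- `G` preserves a nondegenerate (possibly indefinite) Hermitian form on `ℂ²`. -/
def IsUnitaryGroup (G : Subgroup (GL (Fin 2) ℂ)) : Prop :=
  ∃ H : Matrix (Fin 2) (Fin 2) ℂ, H.IsHermitian ∧ H.det ≠ 0 ∧
    ∀ g ∈ G, (g : Matrix (Fin 2) (Fin 2) ℂ)ᴴ * H * (g : Matrix (Fin 2) (Fin 2) ℂ) = H

/-- In `ℂ \ S`, the loop `ℓ` is freely homotopic to the circle with centre `c` and radius `r`,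
traversed once counter-clockwise. -/
def FreelyHomotopicToCircle {S : Set ℂ} {b : ↥Sᶜ} (ℓ : Path b b) (c : ℂ) (r : ℝ) : Prop :=
  ∃ H : C(I × I, ↥Sᶜ),
    (∀ t, H (0, t) = ℓ t) ∧
    (∀ t : I, (H (1, t) : ℂ) = circleMap c r (2 * Real.pi * t)) ∧
    ∀ s, H (s, 0) = H (s, 1)

/-- `ℓ` is a simple positive loop, up to free homotopy in `ℂ \ S`, around `c` and no other point
of `S`. -/
def IsLoopAround {S : Set ℂ} {b : ↥Sᶜ} (ℓ : Path b b) (c : ℂ) : Prop :=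
  ∃ r : ℝ, 0 < r ∧ (∀ s ∈ S, s ≠ c → r < dist s c) ∧ FreelyHomotopicToCircle ℓ c r

/-- `ℓ` is a simple positive loop, up to free homotopy in `ℂ \ S`, around all of `S`. -/
def IsLoopAroundAll {S : Set ℂ} {b : ↥Sᶜ} (ℓ : Path b b) : Prop :=
  ∃ r : ℝ, 0 < r ∧ (∀ s ∈ S, ‖s‖ < r) ∧ FreelyHomotopicToCircle ℓ 0 r

/-- The finite singular points of the Heun equation. -/
abbrev heunSing (a : ℂ) : Set ℂ := {0, 1, a}

/-- A standard system of loops around `0`, `1`, `a`: each is a local loop around its puncture, they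
generate the fundamental group, and their product, in one of the two cyclic orders, is a loop
around all three punctures. -/
structure IsStandardLoopSystem (a : ℂ) {b : ↥(heunSing a)ᶜ} (ℓ₀ ℓ₁ ℓₐ : Path b b) : Prop where
  around_zero : IsLoopAround ℓ₀ 0
  around_one : IsLoopAround ℓ₁ 1
  around_a : IsLoopAround ℓₐ a
  generate : Subgroup.closure ({FundamentalGroup.fromPath ⟦ℓ₀⟧, FundamentalGroup.fromPath ⟦ℓ₁⟧,
    FundamentalGroup.fromPath ⟦ℓₐ⟧} : Set (FundamentalGroup ↥(heunSing a)ᶜ b)) = ⊤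
  around_all : IsLoopAroundAll ((ℓ₀.trans ℓ₁).trans ℓₐ) ∨ IsLoopAroundAll ((ℓ₀.trans ℓₐ).trans ℓ₁)

/-- The coefficient of `y'` in the Heun equation. -/
noncomputable def heunP (γ δ ε a : ℂ) (z : ℂ) : ℂ := γ / z + δ / (z - 1) + ε / (z - a)

/-- The coefficient of `y` in the Heun equation. -/
noncomputable def heunQ (α β a B : ℂ) (z : ℂ) : ℂ :=
  (α * β * z - B / 4) / (z * (z - 1) * (z - a))

/-- The matrix `e^{π i c} M`. -/
noncomputable def rescale (c : ℂ) (M : GL (Fin 2) ℂ) : Matrix (Fin 2) (Fin 2) ℂ :=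
  Complex.exp (Real.pi * Complex.I * c) • (M : Matrix (Fin 2) (Fin 2) ℂ)

/-- `γ, δ, ε` are real, and either `α, β` are real or `α - conj β` is an integer. -/
def HeunParameterCondition (α β γ δ ε : ℂ) : Prop :=
  (γ.im = 0 ∧ δ.im = 0 ∧ ε.im = 0) ∧
    ((α.im = 0 ∧ β.im = 0) ∨ ∃ n : ℤ, α - (starRingEnd ℂ) β = n)

/-- The congruences modulo `1` on `α` which can make the monodromy group reducible. -/
def HeunReducibleCongruence (α γ δ ε : ℂ) : Prop :=
  ∃ s ∈ ({0, γ, δ, ε, γ + δ, γ + ε, δ + ε, γ + δ + ε} : Set ℂ), ∃ n : ℤ, α = s + n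

/-- The traces of all products of two of the three matrices are real. -/
def PairTracesReal (P₀ Q₀ R₀ : Matrix (Fin 2) (Fin 2) ℂ) : Prop :=
  (P₀ * Q₀).trace.im = 0 ∧ (Q₀ * R₀).trace.im = 0 ∧ (P₀ * R₀).trace.im = 0

/-! The analysis serves only to find traces and determinants. Solutions are continued by lifting to
a covering space, and transports of Cauchy data `(y, y')` along freely homotopic loops are
conjugate, so a local monodromy may be computed on circles of any admissible radius. As the radius
tends to `0` or `∞`, the system for `(y, ζ y' - u y)` approaches an Euler system with constant
coefficients, and Grönwall's inequality passes to the limit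
(`trace_det_of_freelyHomotopicToCircle`). Thus `P`, `Q`, `R` have eigenvalues `1` and `e^{-2πiγ}`,
`e^{-2πiδ}`, `e^{-2πiε}` respectively, and their product around all punctures has eigenvalues
`e^{-2πiα}`, `e^{-2πiβ}`. A common eigenvector would force one of the excluded congruences.

The rest is algebra of `2 × 2` matrices. The rescaled matrices are unimodular, with traces `2 cos
πγ`, `2 cos πδ`, `2 cos πε`, and the rescaled triple product has trace `-2 cos π(α - β)`. A
unimodular isometry `X` of `H` is similar to `(Xᴴ)⁻¹`, so its trace is real; together with `|det P|
= 1` this gives necessity.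

Conversely, Cayley–Hamilton reduces every trace on the real algebra `A` generated by the triple to
the traces of ordered products of distinct generators (`trace_im_eq_zero_of_mem_adjoin`). By
irreducibility `A` spans `Mat2` over `ℂ` (Burnside), and real traces force `A ∩ iA = 0`, that is
`dim A = 4`. Then `X ↦ (adj X)ᴴ` on `A` extends to a complex algebra map of `Mat2 = A ⊕ iA`; an
intertwiner in the manner of Skolem–Noether (`exists_intertwiner`), symmetrised, is the required
form (`exists_hermitian`). -/

/-! ### Local solutions of holomorphic linear systems. -/

section LocalSolutions

open Metric Set Filter

variable {𝔸 : Type*} [NormedRing 𝔸] [NormedAlgebra ℂ 𝔸] [CompleteSpace 𝔸]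

/-- A holomorphic linear system `Y' = a Y` on an open set has, near each point, a solution with
value `1` at that point (Picard iteration). -/
theorem exists_local_solution {U : Set ℂ} (hU : IsOpen U) {a : ℂ → 𝔸}
    (ha : DifferentiableOn ℂ a U) {x : ℂ} (hx : x ∈ U) :
    ∃ r > 0, ball x r ⊆ U ∧ ∃ Φ : ℂ → 𝔸, Φ x = 1 ∧
      ∀ z ∈ ball x r, HasDerivAt Φ (a z * Φ z) z := by
  have hcont : ContinuousAt a x := (ha.differentiableAt (hU.mem_nhds hx)).continuousAt
  have hbd : ∀ᶠ z in 𝓝 x, ‖a z‖ ≤ ‖a x‖ + 1 :=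
    (hcont.norm.eventually_lt continuousAt_const (by simp)).mono fun z hz => hz.le
  obtain ⟨r₀, hr₀, hr₀U⟩ := Metric.eventually_nhds_iff_ball.1 (hbd.and (hU.mem_nhds hx))
  set K : ℝ := ‖a x‖ + 1 with hK
  have hKpos : 0 < K := by positivity
  -- This radius gives `K * r ≤ 1 / 2`, so each Picard step (multiply by `a`, integrate from `x`) at
  -- least halves the bound on the ball.
  set r : ℝ := min r₀ (1 / (2 * K)) with hr
  have hrpos : 0 < r := lt_min hr₀ (by positivity)
  have hKr : K * r ≤ 1 / 2 := by
    calc K * r ≤ K * (1 / (2 * K)) := by gcongr; exact min_le_right _ _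
      _ = 1 / 2 := by field_simp
  have hB : ∀ z ∈ ball x r, ‖a z‖ ≤ K ∧ z ∈ U := fun z hz =>
    hr₀U z (ball_subset_ball (min_le_left _ _) hz)
  -- Differentiability sits behind the existential so that `choose` gives a Picard operator `T`
  -- defined on all functions, which can be iterated.
  have hprim : ∀ f : ℂ → 𝔸, ∃ g : ℂ → 𝔸, DifferentiableOn ℂ f (ball x r) →
      g x = 0 ∧ ∀ z ∈ ball x r, HasDerivAt g (a z * f z) z := by
    intro f
    by_cases hf : DifferentiableOn ℂ f (ball x r)
    · obtain ⟨g, h0, h1⟩ := ((ha.mono fun z hz => (hB z hz).2).mul hf).isExactOn_ball.with_val_at x 0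
      exact ⟨g, fun _ => ⟨h0, h1⟩⟩
    · exact ⟨0, fun h => (hf h).elim⟩
  choose T hT using hprim
  let y : ℕ → ℂ → 𝔸 := fun n => Nat.rec (fun _ => 1) (fun _ f => T f) n
  have hy0 : y 0 = fun _ => 1 := rfl
  have hys : ∀ n, y (n + 1) = T (y n) := fun n => rfl
  have hdiff : ∀ n, DifferentiableOn ℂ (y n) (ball x r) := by
    intro n
    induction n with
    | zero => rw [hy0]; exact differentiableOn_const _
    | succ n ih =>
      rw [hys]
      exact fun z hz => ((hT (y n) ih).2 z hz).differentiableAt.differentiableWithinAt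
  have hder : ∀ n, ∀ z ∈ ball x r, HasDerivAt (y (n + 1)) (a z * y n z) z := fun n =>
    (hT (y n) (hdiff n)).2
  have hzero : ∀ n, y (n + 1) x = 0 := fun n => (hT (y n) (hdiff n)).1
  have hnorm : ∀ n, ∀ z ∈ ball x r, ‖y n z‖ ≤ ‖(1 : 𝔸)‖ * (1 / 2) ^ n := by
    intro n
    induction n with
    | zero => intro z _; simp [hy0]
    | succ n ih =>
      intro z hz
      have hxr : x ∈ ball x r := mem_ball_self hrpos
      have := (convex_ball x r).norm_image_sub_le_of_norm_hasDerivWithin_le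
        (fun w hw => (hder n w hw).hasDerivWithinAt)
        (fun w hw => (norm_mul_le _ _).trans
          (mul_le_mul (hB w hw).1 (ih w hw) (norm_nonneg _) hKpos.le)) hxr hz
      rw [hzero, sub_zero] at this
      refine this.trans ?_
      have hz' : ‖z - x‖ ≤ r := (mem_ball_iff_norm.1 hz).le
      calc K * (‖(1 : 𝔸)‖ * (1 / 2) ^ n) * ‖z - x‖
          ≤ K * (‖(1 : 𝔸)‖ * (1 / 2) ^ n) * r := by gcongr
        _ = (K * r) * (‖(1 : 𝔸)‖ * (1 / 2) ^ n) := by ring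
        _ ≤ (1 / 2) * (‖(1 : 𝔸)‖ * (1 / 2) ^ n) := by gcongr
        _ = _ := by ring
  have hsum : Summable fun n : ℕ => ‖(1 : 𝔸)‖ * (1 / 2 : ℝ) ^ n :=
    summable_geometric_two.mul_left _
  refine ⟨r, hrpos, fun z hz => (hB z hz).2, fun z => ∑' n, y n z, ?_, fun z hz => ?_⟩
  · change ∑' n, y n x = 1
    rw [tsum_eq_single 0]
    · simp [hy0]
    · rintro (_ | n) hn
      · exact (hn rfl).elim
      · exact hzero n
  · have hd := (Complex.differentiableOn_tsum_of_summable_norm hsum hdiff isOpen_ball hnorm).differentiableAt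
      (isOpen_ball.mem_nhds hz)
    have hs := Complex.hasSum_deriv_of_summable_norm hsum hdiff isOpen_ball hnorm hz
    have hsy : Summable fun n => y n z :=
      Summable.of_norm_bounded hsum fun n => hnorm n z hz
    have h2 : HasSum (fun n => deriv (y n) z) (a z * ∑' n, y n z) := by
      -- The term `y 0` is constant, so dropping it and shifting the index turns the series of
      -- derivatives into `a z` times the series itself.
      rw [← hasSum_nat_add_iff' 1]
      have : (fun n => deriv (y (n + 1)) z) = fun n => a z * y n z :=
        funext fun n => (hder n z hz).deriv
      rw [this]
      simpa [hy0] using hsy.hasSum.mul_left (a z)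
    rw [← hs.unique h2]
    exact hd.hasDerivAt

/-- Fundamental solutions together with their inverses. -/
theorem exists_local_fundamental {U : Set ℂ} (hU : IsOpen U) {a : ℂ → 𝔸}
    (ha : DifferentiableOn ℂ a U) {x : ℂ} (hx : x ∈ U) :
    ∃ r > 0, ball x r ⊆ U ∧ ∃ Φ Ψ : ℂ → 𝔸, Φ x = 1 ∧
      ∀ z ∈ ball x r, HasDerivAt Φ (a z * Φ z) z ∧ HasDerivAt Ψ (-(Ψ z * a z)) z ∧
        Φ z * Ψ z = 1 ∧ Ψ z * Φ z = 1 := by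
  obtain ⟨r, hr, hrU, Φ, hΦx, hΦ⟩ := exists_local_solution hU ha hx
  have hc : ContinuousAt Φ x := (hΦ x (mem_ball_self hr)).continuousAt
  have hunit : ∀ᶠ z in 𝓝 x, IsUnit (Φ z) :=
    hc.eventually (by rw [hΦx]; exact Units.isOpen.mem_nhds isUnit_one)
  obtain ⟨s, hs, hsu⟩ := Metric.eventually_nhds_iff_ball.1 hunit
  refine ⟨min r s, lt_min hr hs, (ball_subset_ball (min_le_left _ _)).trans hrU, Φ,
    fun z => Ring.inverse (Φ z), hΦx, fun z hz => ?_⟩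
  have hz1 := hΦ z (ball_subset_ball (min_le_left _ _) hz)
  have hz2 := hsu z (ball_subset_ball (min_le_right _ _) hz)
  refine ⟨hz1, ?_, Ring.mul_inverse_cancel _ hz2, Ring.inverse_mul_cancel _ hz2⟩
  obtain ⟨u, hu⟩ := hz2
  have h := (hu ▸ hasFDerivAt_ringInverse (𝕜 := ℂ) u : HasFDerivAt Ring.inverse _ (Φ z))
  convert! h.comp_hasDerivAt z hz1 using 1
  simp [← hu, mul_assoc]

omit [CompleteSpace 𝔸] in
/-- Every solution of `Y' = a Y` is a constant right multiple of a fundamental solution. -/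
theorem eventually_eq_mul_const {a : ℂ → 𝔸}
    {x : ℂ} {r : ℝ} {Φ Ψ Y : ℂ → 𝔸} {z : ℂ} (hz : z ∈ ball x r)
    (hΦ : ∀ z ∈ ball x r, HasDerivAt Ψ (-(Ψ z * a z)) z ∧ Φ z * Ψ z = 1)
    (hY : ∀ᶠ w in 𝓝 z, HasDerivAt Y (a w * Y w) w) :
    ∀ᶠ w in 𝓝 z, Y w = Φ w * (Ψ z * Y z) := by
  obtain ⟨s, hs, hsY⟩ := Metric.eventually_nhds_iff_ball.1 (hY.and (isOpen_ball.mem_nhds hz))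
  -- Variation of constants: `(Ψ Y)' = -Ψ a Y + Ψ a Y = 0`.
  have hconst : ∀ w ∈ ball z s, Ψ w * Y w = Ψ z * Y z := by
    intro w hw
    refine (isOpen_ball (x := z) (ε := s)).is_const_of_deriv_eq_zero
      (convex_ball z s).isPreconnected (f := fun w => Ψ w * Y w) ?_ ?_ hw (mem_ball_self hs)
    · intro v hv
      exact ((hΦ v (hsY v hv).2).1.mul (hsY v hv).1).differentiableAt.differentiableWithinAt
    · intro v hv
      have := ((hΦ v (hsY v hv).2).1.mul (hsY v hv).1).deriv
      simp only [Pi.zero_apply]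
      refine Eq.trans this ?_
      noncomm_ring
  filter_upwards [ball_mem_nhds z hs] with w hw
  rw [← hconst w hw, ← mul_assoc, (hΦ w (hsY w hw).2).2, one_mul]

end LocalSolutions

/-! ### Continuation of solutions along maps: uniqueness and lifting. -/

section Horizontal

open Metric Set Filter

variable {𝔸 : Type*} [NormedRing 𝔸] [NormedAlgebra ℂ 𝔸]
  {Z Z' : Type*} [TopologicalSpace Z] [TopologicalSpace Z']

/-- `W` is a lift of `h` that is locally the pull-back of solutions of `Y' = a Y`. -/
def IsHorizontal (a : ℂ → 𝔸) (h : Z → ℂ) (W : Z → 𝔸) : Prop :=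
  ∀ z₀, ∃ Y : ℂ → 𝔸, (∀ᶠ x in 𝓝 (h z₀), HasDerivAt Y (a x * Y x) x) ∧
    ∀ᶠ z in 𝓝 z₀, W z = Y (h z)

namespace IsHorizontal

variable {a : ℂ → 𝔸} {h : Z → ℂ} {W W' : Z → 𝔸}

theorem comp (hW : IsHorizontal a h W) {g : Z' → Z} (hg : Continuous g) :
    IsHorizontal a (fun z => h (g z)) (fun z => W (g z)) := fun z₀ => by
  obtain ⟨Y, hY, hWY⟩ := hW (g z₀)
  exact ⟨Y, hY, (hg.tendsto z₀).eventually hWY⟩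

theorem mul_const (hW : IsHorizontal a h W) (C : 𝔸) : IsHorizontal a h (fun z => W z * C) :=
  fun z₀ => by
  obtain ⟨Y, hY, hWY⟩ := hW z₀
  refine ⟨fun x => Y x * C, hY.mono fun x hx => ?_, hWY.mono fun z hz => by simp only [hz]⟩
  simpa [mul_assoc] using hx.mul_const C

theorem sub (hW : IsHorizontal a h W) (hW' : IsHorizontal a h W') :
    IsHorizontal a h (fun z => W z - W' z) := fun z₀ => by
  obtain ⟨Y, hY, hWY⟩ := hW z₀
  obtain ⟨Y', hY', hWY'⟩ := hW' z₀
  refine ⟨fun x => Y x - Y' x, ?_, ?_⟩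
  · filter_upwards [hY, hY'] with x hx hx'
    simpa [mul_sub, Pi.sub_def] using! hx.sub hx'
  · filter_upwards [hWY, hWY'] with z hz hz'
    rw [hz, hz']

variable [CompleteSpace 𝔸] {U : Set ℂ}

/-- Near `z₀`, `W` is `W z₀` multiplied on the left by an invertible value of a fundamental
solution. The equivalence makes the zero set both open and closed. -/
theorem eventually_eq_zero_iff (hU : IsOpen U) (ha : DifferentiableOn ℂ a U)
    (hh : Continuous h) (hhU : ∀ z, h z ∈ U) (hW : IsHorizontal a h W) (z₀ : Z) :
    ∀ᶠ z in 𝓝 z₀, (W z = 0 ↔ W z₀ = 0) := by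
  obtain ⟨Y, hY, hWY⟩ := hW z₀
  obtain ⟨r, hr, hrU, Φ, Ψ, hx, hΦ⟩ := exists_local_fundamental hU ha (hhU z₀)
  have h1 := eventually_eq_mul_const (mem_ball_self hr) (fun z hz => ⟨(hΦ z hz).2.1, (hΦ z hz).2.2.1⟩) hY
  have hΨ : Ψ (h z₀) = 1 := by
    have := (hΦ _ (mem_ball_self hr)).2.2.1
    rwa [hx, one_mul] at this
  filter_upwards [hWY, (hh.tendsto z₀).eventually (h1.and (ball_mem_nhds _ hr))] with z hz h2
  rw [hz, h2.1, hΨ, one_mul, hWY.self_of_nhds]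
  refine ⟨fun h0 => ?_, fun h0 => by rw [h0, mul_zero]⟩
  have := congrArg (Ψ (h z) * ·) h0
  simpa [← mul_assoc, (hΦ _ h2.2).2.2.2] using this

theorem unique [PreconnectedSpace Z] (hU : IsOpen U) (ha : DifferentiableOn ℂ a U)
    (hh : Continuous h) (hhU : ∀ z, h z ∈ U) (hW : IsHorizontal a h W)
    (hW' : IsHorizontal a h W') {z₀ : Z} (h0 : W z₀ = W' z₀) (z : Z) : W z = W' z := by
  have key := (hW.sub hW').eventually_eq_zero_iff hU ha hh hhU
  have hclopen : IsClopen {z | W z - W' z = 0} := by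
    refine ⟨⟨isOpen_iff_mem_nhds.2 fun z hz => ?_⟩, isOpen_iff_mem_nhds.2 fun z hz => ?_⟩
    · exact (key z).mono fun w hw h => hz (hw.1 h)
    · exact (key z).mono fun w hw => hw.2 hz
  have := hclopen.eq_univ ⟨z₀, sub_eq_zero.2 h0⟩
  exact sub_eq_zero.1 (this ▸ mem_univ z : z ∈ {z | W z - W' z = 0})

/-- The bundle of values of solutions, with the flat topology. -/
noncomputable def flatCore (𝔽 : Type*) [TopologicalSpace 𝔽] [DiscreteTopology 𝔽] (e : 𝔽 ≃ 𝔸)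
    (a : ℂ → 𝔸) (U : Set ℂ) (r : U → ℝ) (Φ Ψ : U → ℂ → 𝔸)
    (hr : ∀ x, 0 < r x)
    (hΦ : ∀ x : U, ∀ z ∈ ball (x : ℂ) (r x), HasDerivAt (Φ x) (a z * Φ x z) z ∧
      HasDerivAt (Ψ x) (-(Ψ x z * a z)) z ∧ Φ x z * Ψ x z = 1 ∧ Ψ x z * Φ x z = 1) :
    FiberBundleCore U U 𝔽 where
  baseSet x := {z | (z : ℂ) ∈ ball (x : ℂ) (r x)}
  isOpen_baseSet x := isOpen_ball.preimage continuous_subtype_val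
  indexAt x := x
  mem_baseSet_at x := mem_ball_self (hr x)
  -- In the chart at `x` the label `v` stands for the solution `Φ x * e v`. Relabelling in the chart
  -- at `x'` is locally constant in `z`, because `Φ x` is a constant right multiple of `Φ x'` near
  -- `z`; hence it is continuous for discrete fibres.
  coordChange x x' z v := e.symm (Ψ x' z * (Φ x z * e v))
  coordChange_self x z hz v := by
    rw [← mul_assoc, (hΦ x z hz).2.2.2, one_mul, e.symm_apply_apply]
  continuousOn_coordChange x x' := by
    rintro ⟨z, v⟩ ⟨⟨hz, hz'⟩, -⟩
    refine ContinuousAt.continuousWithinAt ?_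
    have h1 := eventually_eq_mul_const (z := (z : ℂ)) (r := r x') (x := x') (Φ := Φ x') hz'
      (fun z hz => ⟨(hΦ x' z hz).2.1, (hΦ x' z hz).2.2.1⟩)
      (Filter.mem_of_superset (isOpen_ball.mem_nhds hz) fun w hw => (hΦ x w hw).1 :
        ∀ᶠ w in 𝓝 (z : ℂ), HasDerivAt (Φ x) (a w * Φ x w) w)
    have h2 : ∀ᶠ p : U × 𝔽 in 𝓝 (z, v), e.symm (Ψ x' p.1 * (Φ x p.1 * e p.2))
        = e.symm (Ψ x' z * (Φ x z * e v)) := by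
      rw [nhds_prod_eq, nhds_discrete 𝔽]
      have h3 : ∀ᶠ w : U in 𝓝 z, Φ x w = Φ x' w * (Ψ x' z * Φ x z) ∧ (w : ℂ) ∈ ball (x' : ℂ) (r x') :=
        (continuous_subtype_val.tendsto z).eventually (h1.and (isOpen_ball.mem_nhds hz'))
      have h4 : ∀ᶠ w : 𝔽 in pure v, w = v := rfl
      filter_upwards [h3.prod_mk h4] with p hp
      rw [hp.2, hp.1.1, ← mul_assoc, ← mul_assoc, (hΦ x' _ hp.1.2).2.2.2, one_mul, mul_assoc]
    exact (continuousAt_const (y := e.symm (Ψ x' z * (Φ x z * e v)))).congr (h2.mono fun p hp => hp.symm)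
  coordChange_comp x x' x'' z hz v := by
    rw [e.apply_symm_apply, ← mul_assoc (Φ x' z), (hΦ x' z hz.1.2).2.2.1, one_mul]

/-- Solutions can be continued along maps from simply connected spaces. -/
theorem exists_lift [SimplyConnectedSpace Z] [LocallyPathConnectedSpace Z]
    (hU : IsOpen U) (ha : DifferentiableOn ℂ a U)
    (hh : Continuous h) (hhU : ∀ z, h z ∈ U) (z₀ : Z) (w₀ : 𝔸) :
    ∃ W : Z → 𝔸, IsHorizontal a h W ∧ W z₀ = w₀ := by
  have hloc : ∀ x : U, _ := fun x => exists_local_fundamental hU ha x.2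
  choose r hr hrU Φ Ψ hΦx hΦ using hloc
  -- An opaque copy of `𝔸` keeps the discrete topology of the fibre apart from the norm topology.
  -- With discrete fibres the bundle is a covering space, so maps from a simply connected space
  -- lift.
  obtain ⟨𝔽, _, _, ⟨e⟩⟩ : ∃ (𝔽 : Type _) (_ : TopologicalSpace 𝔽) (_ : DiscreteTopology 𝔽),
    Nonempty (𝔽 ≃ 𝔸) := ⟨𝔸, ⊥, @DiscreteTopology.mk 𝔸 ⊥ rfl, ⟨Equiv.refl _⟩⟩
  let C := flatCore 𝔽 e a U r Φ Ψ hr hΦ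
  have cov : IsCoveringMap (Bundle.TotalSpace.proj : C.TotalSpace → U) :=
    FiberBundle.isCoveringMap (F := 𝔽) (E := C.Fiber)
  let f : C(Z, U) := ⟨fun z => ⟨h z, hhU z⟩, by fun_prop⟩
  obtain ⟨F, ⟨hF0, hF⟩, -⟩ := cov.existsUnique_continuousMap_lifts f z₀
    (⟨f z₀, e.symm w₀⟩ : C.TotalSpace) rfl
  have hproj : ∀ z, (F z).proj = f z := congrFun hF
  let W : Z → 𝔸 := fun z => e (F z).2
  have hW : ∀ z, W z = e (F z).2 := fun z => rfl
  refine ⟨W, fun z₁ => ?_, ?_⟩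
  · set x : U := f z₁ with hx
    have hmem : F z₁ ∈ (C.localTriv x).source := by
      rw [C.mem_localTriv_source, hproj]
      exact mem_ball_self (hr x)
    have hsrc : ∀ᶠ z in 𝓝 z₁, F z ∈ (C.localTriv x).source :=
      F.continuous.continuousAt.eventually ((C.localTriv x).open_source.mem_nhds hmem)
    have hcont : ContinuousAt (fun z => ((C.localTriv x) (F z)).2) z₁ :=
      continuous_snd.continuousAt.comp
        (((C.localTriv x).continuousOn.continuousAt
          ((C.localTriv x).open_source.mem_nhds hmem)).comp F.continuous.continuousAt)
    have hloc : ∀ᶠ z in 𝓝 z₁, ((C.localTriv x) (F z)).2 = ((C.localTriv x) (F z₁)).2 :=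
      hcont.eventually_mem ((isOpen_discrete {_}).mem_nhds rfl)
    set c : 𝔸 := e ((C.localTriv x) (F z₁)).2
    refine ⟨fun w => Φ x w * c, ?_, ?_⟩
    · filter_upwards [isOpen_ball.mem_nhds (mem_ball_self (hr x) : h z₁ ∈ ball (x : ℂ) (r x))]
        with w hw
      simpa [mul_assoc] using (hΦ x w hw).1.mul_const c
    · filter_upwards [hloc, hsrc] with z hz hzs
      have hzb : h z ∈ ball (x : ℂ) (r x) := by
        rw [C.mem_localTriv_source, hproj] at hzs
        exact hzs
      -- Since `indexAt x = x` and `Φ x x = 1`, the fibre coordinate over a point is the value of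
      -- the solution there.
      have hval : e ((C.localTriv x) (F z)).2 = Ψ x (h z) * W z := by
        have h1 : ((C.localTriv x) (F z)).2
          = e.symm (Ψ x (F z).proj * (Φ (F z).proj (F z).proj * e (F z).2)) := rfl
        rw [h1, e.apply_symm_apply, hΦx, one_mul, hproj, hW]
        rfl
      rw [show c = e ((C.localTriv x) (F z)).2 by rw [hz], hval, ← mul_assoc,
        (hΦ x _ hzb).2.2.1, one_mul]
  · rw [hW, hF0]
    exact e.apply_symm_apply w₀

end IsHorizontal
end Horizontal

/-! ### Transport along paths and its homotopy invariance. -/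

section Transport

open Set Filter

variable {𝔸 : Type*} [NormedRing 𝔸] [NormedAlgebra ℂ 𝔸]

/-- `T` is the value at the end of `h` of the solution of `Y' = a Y` continued along `h` with
initial value `1`. -/
def IsTransport (a : ℂ → 𝔸) (h : I → ℂ) (T : 𝔸) : Prop :=
  ∃ W, IsHorizontal a h W ∧ W 0 = 1 ∧ W 1 = T

variable [CompleteSpace 𝔸] {a : ℂ → 𝔸} {U : Set ℂ}

/-- Lift `h ∘ ρ` on `Z'` and restrict along `ι`. Only `Z'` must be simply connected, so the interval
and the square are treated through `ℝ` and `ℝ × ℝ`. -/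
theorem IsHorizontal.exists_lift_of_retract {Z Z' : Type*} [TopologicalSpace Z]
    [TopologicalSpace Z'] [SimplyConnectedSpace Z'] [LocallyPathConnectedSpace Z']
    {ι : Z → Z'} {ρ : Z' → Z} (hι : Continuous ι) (hρ : Continuous ρ) (hρι : ∀ z, ρ (ι z) = z)
    (hU : IsOpen U) (ha : DifferentiableOn ℂ a U) {h : Z → ℂ}
    (hh : Continuous h) (hhU : ∀ z, h z ∈ U) (z₀ : Z) (w₀ : 𝔸) :
    ∃ W : Z → 𝔸, IsHorizontal a h W ∧ W z₀ = w₀ := by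
  obtain ⟨W, hW, hW0⟩ := IsHorizontal.exists_lift hU ha (hh.comp hρ) (fun z => hhU (ρ z)) (ι z₀) w₀
  refine ⟨fun z => W (ι z), ?_, hW0⟩
  simpa only [Function.comp_apply, hρι] using hW.comp hι

theorem IsHorizontal.exists_lift_unitInterval (hU : IsOpen U) (ha : DifferentiableOn ℂ a U)
    {h : I → ℂ} (hh : Continuous h) (hhU : ∀ z, h z ∈ U) (t : I) (w : 𝔸) :
    ∃ W : I → 𝔸, IsHorizontal a h W ∧ W t = w :=
  IsHorizontal.exists_lift_of_retract (ι := ((↑) : I → ℝ)) (ρ := projIcc (0 : ℝ) 1 zero_le_one)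
    continuous_subtype_val continuous_projIcc (fun z => projIcc_val _ z) hU ha hh hhU t w

theorem IsHorizontal.exists_lift_square (hU : IsOpen U) (ha : DifferentiableOn ℂ a U)
    {h : I × I → ℂ} (hh : Continuous h) (hhU : ∀ z, h z ∈ U) (t : I × I) (w : 𝔸) :
    ∃ W : I × I → 𝔸, IsHorizontal a h W ∧ W t = w :=
  IsHorizontal.exists_lift_of_retract (ι := fun z : I × I => ((z.1 : ℝ), (z.2 : ℝ)))
    (ρ := fun z : ℝ × ℝ => (projIcc (0 : ℝ) 1 zero_le_one z.1, projIcc (0 : ℝ) 1 zero_le_one z.2))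
    (by fun_prop) (by fun_prop) (fun z => by simp) hU ha hh hhU t w

namespace IsTransport

theorem exists_transport (hU : IsOpen U) (ha : DifferentiableOn ℂ a U)
    {h : I → ℂ} (hh : Continuous h) (hhU : ∀ z, h z ∈ U) : ∃ T, IsTransport a h T := by
  obtain ⟨W, hW, hW0⟩ := IsHorizontal.exists_lift_unitInterval hU ha hh hhU 0 1
  exact ⟨W 1, W, hW, hW0, rfl⟩

/-- Solutions may be multiplied on the right by constants, so by uniqueness every horizontal lift is
the normalised one times its initial value. -/
theorem apply_one_eq {h : I → ℂ} {T : 𝔸} (hT : IsTransport a h T)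
    (hU : IsOpen U) (ha : DifferentiableOn ℂ a U)
    (hh : Continuous h) (hhU : ∀ z, h z ∈ U) {W : I → 𝔸} (hW : IsHorizontal a h W) :
    W 1 = T * W 0 := by
  obtain ⟨V, hV, hV0, rfl⟩ := hT
  exact hW.unique hU ha hh hhU (hV.mul_const (W 0)) (z₀ := 0) (by rw [hV0, one_mul]) 1

theorem eq {h : I → ℂ} {T T' : 𝔸} (hT : IsTransport a h T) (hT' : IsTransport a h T')
    (hU : IsOpen U) (ha : DifferentiableOn ℂ a U)
    (hh : Continuous h) (hhU : ∀ z, h z ∈ U) : T' = T := by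
  obtain ⟨V, hV, hV0, rfl⟩ := hT'
  rw [hT.apply_one_eq hU ha hh hhU hV, hV0, mul_one]

theorem symm_mul {h : I → ℂ} {T T' : 𝔸} (hT : IsTransport a h T)
    (hT' : IsTransport a (fun t => h (σ t)) T')
    (hU : IsOpen U) (ha : DifferentiableOn ℂ a U)
    (hh : Continuous h) (hhU : ∀ z, h z ∈ U) : T' * T = 1 := by
  obtain ⟨V, hV, hV0, rfl⟩ := hT
  have := hT'.apply_one_eq hU ha (by fun_prop) (fun z => hhU _) (hV.comp unitInterval.continuous_symm)
  simpa [hV0] using this.symm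

theorem isUnit {h : I → ℂ} {T : 𝔸} (hT : IsTransport a h T)
    (hU : IsOpen U) (ha : DifferentiableOn ℂ a U)
    (hh : Continuous h) (hhU : ∀ z, h z ∈ U) : IsUnit T := by
  obtain ⟨T', hT'⟩ := exists_transport (h := fun t => h (σ t)) hU ha (by fun_prop) (fun z => hhU _)
  exact ⟨⟨T, T', hT'.symm_mul (by simpa using hT) hU ha (by fun_prop) (fun z => hhU _),
    hT.symm_mul hT' hU ha hh hhU⟩, rfl⟩

/-- Transports along freely homotopic closed curves are conjugate. -/
theorem conj_of_freeHomotopy {H : I × I → ℂ} (hH : Continuous H) (hHU : ∀ z, H z ∈ U)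
    (hclosed : ∀ s, H (s, 0) = H (s, 1)) (hU : IsOpen U) (ha : DifferentiableOn ℂ a U)
    {T₀ T₁ : 𝔸} (h0 : IsTransport a (fun t => H (0, t)) T₀)
    (h1 : IsTransport a (fun t => H (1, t)) T₁) :
    ∃ S, IsTransport a (fun s => H (s, 0)) S ∧ T₁ * S = S * T₀ := by
  obtain ⟨W, hW, hW0⟩ := IsHorizontal.exists_lift_square hU ha hH hHU (0, 0) 1
  have e0 := h0.apply_one_eq hU ha (by fun_prop) (fun z => hHU _)
    (hW.comp (g := fun t : I => ((0 : I), t)) (by fun_prop))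
  have e1 := h1.apply_one_eq hU ha (by fun_prop) (fun z => hHU _)
    (hW.comp (g := fun t : I => ((1 : I), t)) (by fun_prop))
  have hl := hW.comp (g := fun s : I => (s, (0 : I))) (by fun_prop)
  have hr := hW.comp (g := fun s : I => (s, (1 : I))) (by fun_prop)
  have hS : IsTransport a (fun s => H (s, 0)) (W (1, 0)) := ⟨_, hl, hW0, rfl⟩
  -- Both vertical sides of the square project to the same curve, hence have the same transport `S`.
  -- Following the square in its two ways gives `W (1, 1) = T₁ * S = S * T₀`.
  simp only [← hclosed] at hr
  have e2 := hS.apply_one_eq hU ha (by fun_prop) (fun z => hHU _) hr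
  refine ⟨W (1, 0), hS, ?_⟩
  simp only [hW0, mul_one] at e0 e1 e2
  rw [← e1, e2, e0]

theorem const {x : ℂ} (hU : IsOpen U) (ha : DifferentiableOn ℂ a U) (hx : x ∈ U) :
    IsTransport a (fun _ => x) 1 := by
  obtain ⟨r, hr, hrU, Φ, hΦx, hΦ⟩ := exists_local_solution hU ha hx
  exact ⟨fun _ => 1, fun z => ⟨Φ, Filter.mem_of_superset (Metric.ball_mem_nhds x hr) hΦ, by simp [hΦx]⟩,
    rfl, rfl⟩

/-- Transport acts on the left, so the path traversed first contributes the right-hand factor. The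
two halves of a horizontal lift are lifts over `p` and `q`. -/
theorem trans {S : Set ℂ} (hS : IsOpen Sᶜ) (ha : DifferentiableOn ℂ a Sᶜ) {x y z : ↥Sᶜ}
    {p : Path x y} {q : Path y z} {T T' : 𝔸} (hT : IsTransport a (fun t => (p t : ℂ)) T)
    (hT' : IsTransport a (fun t => (q t : ℂ)) T') :
    IsTransport a (fun t => (p.trans q t : ℂ)) (T' * T) := by
  obtain ⟨W, hW, hW0⟩ := IsHorizontal.exists_lift_unitInterval hS ha
    (h := fun t => (p.trans q t : ℂ)) (by fun_prop) (fun t => (p.trans q t).2) 0 1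
  refine ⟨W, hW, hW0, ?_⟩
  let g₁ : I → I := fun t => ⟨(t : ℝ) / 2, by have := t.2.1; have := t.2.2; constructor <;> linarith⟩
  let g₂ : I → I := fun t => ⟨((t : ℝ) + 1) / 2, by
    have := t.2.1; have := t.2.2; constructor <;> linarith⟩
  have hg₁ : ∀ t, p.trans q (g₁ t) = p t := fun t => by
    have ht : (g₁ t : ℝ) ≤ 1 / 2 := by change (t : ℝ) / 2 ≤ 1 / 2; linarith [t.2.2]
    rw [Path.trans_apply, dif_pos ht]
    congr 1
    exact Subtype.ext (by change 2 * ((t : ℝ) / 2) = t; ring)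
  have hg₂ : ∀ t, p.trans q (g₂ t) = q t := fun t => by
    have e : ((g₂ t : I) : ℝ) = ((t : ℝ) + 1) / 2 := rfl
    rw [Path.trans_apply]
    split_ifs with ht
    -- The midpoint belongs to the first branch of `Path.trans`, so `t = 0` needs the junction of
    -- the two paths.
    · have ht0 : t = 0 := Subtype.ext (le_antisymm (by rw [e] at ht; change (t : ℝ) ≤ 0; linarith) t.2.1)
      subst ht0
      rw [q.source]
      convert p.target
      simp [e]
    · congr 1
      exact Subtype.ext (by change 2 * (((t : ℝ) + 1) / 2) - 1 = t; ring)
  have h1 := hW.comp (g := g₁) (by fun_prop)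
  have h2 := hW.comp (g := g₂) (by fun_prop)
  simp only [hg₁] at h1
  simp only [hg₂] at h2
  have e1 := hT.apply_one_eq hS ha (by fun_prop) (fun t => (p t).2) h1
  have e2 := hT'.apply_one_eq hS ha (by fun_prop) (fun t => (q t).2) h2
  have i1 : g₁ 0 = 0 := Subtype.ext (by simp [g₁])
  have i2 : g₂ 0 = g₁ 1 := Subtype.ext (by simp [g₁, g₂])
  have i3 : g₂ 1 = 1 := Subtype.ext (by simp [g₂])
  rw [i1, hW0, mul_one] at e1
  rw [← e1, ← i2, ← e2, i3]

/-- With fixed endpoints the conjugating factor is the transport along a constant path, which is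
`1`. -/
theorem of_homotopic {S : Set ℂ} (hS : IsOpen Sᶜ) (ha : DifferentiableOn ℂ a Sᶜ) {b : ↥Sᶜ}
    {p q : Path b b} (hpq : p.Homotopic q) {T : 𝔸} (hT : IsTransport a (fun t => (p t : ℂ)) T) :
    IsTransport a (fun t => (q t : ℂ)) T := by
  obtain ⟨F⟩ := hpq
  obtain ⟨T', hT'⟩ := exists_transport hS ha (h := fun t => (q t : ℂ)) (by fun_prop)
    (fun t => (q t).2)
  obtain ⟨R, hR, hRT⟩ := conj_of_freeHomotopy (H := fun z => (F z : ℂ)) (by fun_prop)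
    (fun z => (F z).2) (fun s => by simp) hS ha (T₀ := T) (T₁ := T') (by simpa using hT)
    (by simpa using hT')
  simp only [Path.Homotopy.source] at hR
  rw [(IsTransport.const hS ha b.2).eq hR hS ha (by fun_prop) (fun _ => b.2), mul_one, one_mul] at hRT
  exact hRT ▸ hT'

end IsTransport

end Transport

/-! ### Second order equations and their monodromy group. -/

section SecondOrder

open Filter Metric

attribute [local instance] Matrix.linftyOpNormedRing Matrix.linftyOpNormedAlgebra

/-- The coefficient matrix of the first order system for `(y, y')`. -/
def companion (p q : ℂ → ℂ) (z : ℂ) : Matrix (Fin 2) (Fin 2) ℂ := !![0, 1; -q z, -p z]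

/-- The matrix with columns `(f i, f i')`. -/
noncomputable def cauchyData (f : Fin 2 → ℂ → ℂ) (z : ℂ) : Matrix (Fin 2) (Fin 2) ℂ :=
  !![f 0 z, f 1 z; deriv (f 0) z, deriv (f 1) z]

/-- The left hand side of `f'' + p f' + q f = 0`. -/
noncomputable def odeResidual (p q f : ℂ → ℂ) (z : ℂ) : ℂ :=
  deriv (deriv f) z + p z * deriv f z + q z * f z

theorem hasDerivAt_matrix {𝕜 : Type*} [NontriviallyNormedField 𝕜] [NormedAlgebra 𝕜 ℂ]
    {f : 𝕜 → Matrix (Fin 2) (Fin 2) ℂ} {f' : Matrix (Fin 2) (Fin 2) ℂ}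
    {x : 𝕜} : HasDerivAt f f' x ↔ ∀ i j, HasDerivAt (fun z => f z i j) (f' i j) x :=
  hasDerivAt_pi.trans (forall_congr' fun _ => hasDerivAt_pi)

variable {p q : ℂ → ℂ}

theorem differentiableOn_companion {U : Set ℂ} (hp : AnalyticOnNhd ℂ p U)
    (hq : AnalyticOnNhd ℂ q U) : DifferentiableOn ℂ (companion p q) U := fun z hz => by
  have : HasDerivAt (companion p q) !![0, 0; -deriv q z, -deriv p z] z := by
    refine hasDerivAt_matrix.2 fun i j => ?_
    fin_cases i <;> fin_cases j
    · exact hasDerivAt_const z (0 : ℂ)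
    · exact hasDerivAt_const z (1 : ℂ)
    · exact (hq z hz).differentiableAt.hasDerivAt.neg
    · exact (hp z hz).differentiableAt.hasDerivAt.neg
  exact this.differentiableAt.differentiableWithinAt

theorem eventually_hasDerivAt_cauchyData {f : Fin 2 → ℂ → ℂ} {x : ℂ}
    (hf : ∀ i, AnalyticAt ℂ (f i) x) (hode : ∀ i, ∀ᶠ z in 𝓝 x, odeResidual p q (f i) z = 0) :
    ∀ᶠ z in 𝓝 x, HasDerivAt (cauchyData f) (companion p q z * cauchyData f z) z := by
  have hf' := fun i => (hf i).eventually_analyticAt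
  filter_upwards [hf' 0, hf' 1, hode 0, hode 1] with z h0 h1 e0 e1
  refine hasDerivAt_matrix.2 fun i j => ?_
  have hr0 : deriv (deriv (f 0)) z = -(q z * f 0 z) + -(p z * deriv (f 0) z) := by
    rw [odeResidual] at e0; linear_combination e0
  have hr1 : deriv (deriv (f 1)) z = -(q z * f 1 z) + -(p z * deriv (f 1) z) := by
    rw [odeResidual] at e1; linear_combination e1
  fin_cases i <;> fin_cases j
  · simpa [cauchyData, companion] using h0.differentiableAt.hasDerivAt
  · simpa [cauchyData, companion] using h1.differentiableAt.hasDerivAt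
  · simpa [cauchyData, companion, hr0] using h0.deriv.differentiableAt.hasDerivAt
  · simpa [cauchyData, companion, hr1] using h1.deriv.differentiableAt.hasDerivAt

theorem odeResidual_congr {f g : ℂ → ℂ} {x : ℂ} (h : f =ᶠ[𝓝 x] g) :
    (∀ᶠ z in 𝓝 x, odeResidual p q f z = 0) ↔ ∀ᶠ z in 𝓝 x, odeResidual p q g z = 0 := by
  refine eventually_congr ?_
  filter_upwards [h, h.deriv, h.deriv.deriv] with z h0 h1 h2
  rw [odeResidual, odeResidual, h0, h1, h2]

/-- An analytic germ satisfies the equation iff its translates to nearby points do. -/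
theorem eventually_odeResidual_iff {f : ℂ → ℂ} {x : ℂ} (hf : AnalyticAt ℂ f x)
    (hp : AnalyticAt ℂ p x) (hq : AnalyticAt ℂ q x) :
    ∀ᶠ w in 𝓝 x, ((∀ᶠ z in 𝓝 w, odeResidual p q f z = 0) ↔
      ∀ᶠ z in 𝓝 x, odeResidual p q f z = 0) := by
  have hR : AnalyticAt ℂ (odeResidual p q f) x :=
    (hf.deriv.deriv.add (hp.mul hf.deriv)).add (hq.mul hf)
  obtain ⟨r, hr, hball⟩ := Metric.eventually_nhds_iff_ball.1 hR.eventually_analyticAt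
  filter_upwards [ball_mem_nhds x hr] with w hw
  have key : ∀ u ∈ ball x r, ∀ v ∈ ball x r, (∀ᶠ z in 𝓝 u, odeResidual p q f z = 0) →
      ∀ᶠ z in 𝓝 v, odeResidual p q f z = 0 := fun u hu v hv h => by
    have := AnalyticOnNhd.eqOn_zero_of_preconnected_of_eventuallyEq_zero hball
      (convex_ball x r).isPreconnected hu h
    exact Filter.mem_of_superset (isOpen_ball.mem_nhds hv) this
  exact ⟨key w hw x (mem_ball_self hr), key x (mem_ball_self hr) w hw⟩

section Continuation

variable {S : Set ℂ} {b : ↥Sᶜ} {y : Fin 2 → ℂ → ℂ}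

/-- By the identity theorem, being a solution is an open and closed condition on the parameter of
the path. -/
theorem odeResidual_of_continuation {c : ↥Sᶜ} {ℓ : Path b c} (hp : AnalyticOnNhd ℂ p Sᶜ)
    (hq : AnalyticOnNhd ℂ q Sᶜ) {F : I → ℂ → ℂ} (hF : ∀ t, AnalyticAt ℂ (F t) (ℓ t : ℂ))
    (hloc : ∀ t, ∀ᶠ s in 𝓝 t, F s =ᶠ[𝓝 (ℓ s : ℂ)] F t)
    (h0 : ∀ᶠ z in 𝓝 (ℓ 0 : ℂ), odeResidual p q (F 0) z = 0) (t : I) :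
    ∀ᶠ z in 𝓝 (ℓ t : ℂ), odeResidual p q (F t) z = 0 := by
  have hℓ : Continuous fun t => (ℓ t : ℂ) := by fun_prop
  have key : ∀ t : I, ∀ᶠ s in 𝓝 t, ((∀ᶠ z in 𝓝 (ℓ s : ℂ), odeResidual p q (F s) z = 0) ↔
      ∀ᶠ z in 𝓝 (ℓ t : ℂ), odeResidual p q (F t) z = 0) := fun t => by
    filter_upwards [hloc t, (hℓ.tendsto t).eventually
      (eventually_odeResidual_iff (hF t) (hp _ (ℓ t).2) (hq _ (ℓ t).2))] with s h1 h2
    exact (odeResidual_congr h1).trans h2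
  have hclopen : IsClopen {t : I | ∀ᶠ z in 𝓝 (ℓ t : ℂ), odeResidual p q (F t) z = 0} := by
    refine ⟨⟨isOpen_iff_mem_nhds.2 fun z hz => ?_⟩, isOpen_iff_mem_nhds.2 fun z hz => ?_⟩
    · exact (key z).mono fun w hw h => hz (hw.1 h)
    · exact (key z).mono fun w hw => hw.2 hz
  exact (hclopen.eq_univ ⟨0, h0⟩ ▸ Set.mem_univ t :
    t ∈ {t : I | ∀ᶠ z in 𝓝 (ℓ t : ℂ), odeResidual p q (F t) z = 0})

theorem cauchyData_congr {f g : Fin 2 → ℂ → ℂ} {x : ℂ} (h : ∀ i, f i =ᶠ[𝓝 x] g i) :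
    cauchyData f x = cauchyData g x := by
  rw [cauchyData, cauchyData, (h 0).eq_of_nhds, (h 1).eq_of_nhds, (h 0).deriv_eq, (h 1).deriv_eq]

/-- The functions occupy columns of `cauchyData` but index rows of `M`, whence the transpose on the
right. -/
theorem cauchyData_combination {x : ℂ} (hy : ∀ i, AnalyticAt ℂ (y i) x)
    (M : Matrix (Fin 2) (Fin 2) ℂ) :
    cauchyData (fun i z => ∑ j, M i j * y j z) x = cauchyData y x * Mᵀ := by
  have hd : ∀ i, deriv (fun z => M i 0 * y 0 z + M i 1 * y 1 z) x
      = M i 0 * deriv (y 0) x + M i 1 * deriv (y 1) x := fun i =>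
    (((hy 0).differentiableAt.hasDerivAt.const_mul (M i 0)).add
      ((hy 1).differentiableAt.hasDerivAt.const_mul (M i 1))).deriv
  ext i j
  fin_cases i <;> fin_cases j <;> simp [cauchyData, Matrix.mul_apply, hd] <;> ring

/-- The monodromy matrix in terms of the transport of Cauchy data. -/
theorem IsMonodromyMatrix.transport_mul (hS : IsOpen Sᶜ) (hp : AnalyticOnNhd ℂ p Sᶜ)
    (hq : AnalyticOnNhd ℂ q Sᶜ) (hy : IsFundamentalSystem p q b y) {ℓ : Path b b}
    {M : GL (Fin 2) ℂ} (hM : IsMonodromyMatrix y ℓ M) {T : Matrix (Fin 2) (Fin 2) ℂ}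
    (hT : IsTransport (companion p q) (fun t => (ℓ t : ℂ)) T) :
    T * cauchyData y b = cauchyData y b * (M : Matrix (Fin 2) (Fin 2) ℂ)ᵀ := by
  choose F hF hloc h0 h1 using hM
  have hode : ∀ i t, ∀ᶠ z in 𝓝 (ℓ t : ℂ), odeResidual p q (F i t) z = 0 := fun i t =>
    odeResidual_of_continuation hp hq (hF i) (hloc i) (by
      rw [ℓ.source]; exact (odeResidual_congr (h0 i)).2 (hy.solution i)) t
  have hhor : IsHorizontal (companion p q) (fun t => (ℓ t : ℂ))
      (fun t => cauchyData (fun i => F i t) (ℓ t)) := fun t =>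
    ⟨cauchyData fun i => F i t,
      eventually_hasDerivAt_cauchyData (fun i => hF i t) (fun i => hode i t), by
        filter_upwards [hloc 0 t, hloc 1 t] with s hs0 hs1
        exact cauchyData_congr (Fin.forall_fin_two.2 ⟨hs0, hs1⟩)⟩
  have := hT.apply_one_eq hS (differentiableOn_companion hp hq) (by fun_prop)
    (fun t => (ℓ t).2) hhor
  rw [ℓ.source, ℓ.target, cauchyData_congr h0, cauchyData_congr h1,
    cauchyData_combination hy.analytic] at this
  exact this.symm

/-- A kernel vector of the Cauchy data at `b` is a combination of solutions with zero initial data;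
it vanishes near `b` by uniqueness, against independence. -/
theorem IsFundamentalSystem.det_cauchyData_ne_zero (hS : IsOpen Sᶜ) (hp : AnalyticOnNhd ℂ p Sᶜ)
    (hq : AnalyticOnNhd ℂ q Sᶜ) (hy : IsFundamentalSystem p q b y) :
    (cauchyData y b).det ≠ 0 := by
  intro hdet
  obtain ⟨c, hc, hc0⟩ := Matrix.exists_mulVec_eq_zero_iff.2 hdet
  refine hc (hy.independent c ?_)
  set C : Matrix (Fin 2) (Fin 2) ℂ := !![c 0, 0; c 1, 0] with hC
  have hY := eventually_hasDerivAt_cauchyData (p := p) (q := q) hy.analytic hy.solution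
  have hYC : ∀ᶠ z in 𝓝 (b : ℂ), HasDerivAt (fun z => cauchyData y z * C)
      (companion p q z * (cauchyData y z * C)) z := hY.mono fun z hz => by
    rw [← mul_assoc]
    exact hz.mul_const C
  obtain ⟨r, hr, hrU, Φ, Ψ, hx, hΦ⟩ :=
    exists_local_fundamental hS (differentiableOn_companion hp hq) b.2
  have h1 := eventually_eq_mul_const (mem_ball_self hr)
    (fun z hz => ⟨(hΦ z hz).2.1, (hΦ z hz).2.2.1⟩) hYC
  have hb : cauchyData y b * C = 0 := by
    have e0 := congrFun hc0 0
    have e1 := congrFun hc0 1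
    simp only [Matrix.mulVec, dotProduct, Fin.sum_univ_two] at e0 e1
    ext i j
    fin_cases i <;> fin_cases j <;> simp [Matrix.mul_apply, hC] <;> assumption
  filter_upwards [h1] with z hz
  rw [hb, mul_zero, mul_zero] at hz
  have := congrFun (congrFun hz 0) 0
  simpa [cauchyData, hC, Matrix.mul_apply, mul_comm] using this

theorem trace_det_of_transport {T W M : Matrix (Fin 2) (Fin 2) ℂ} (hW : W.det ≠ 0)
    (h : T * W = W * Mᵀ) : M.trace = T.trace ∧ M.det = T.det := by
  have hu : IsUnit W.det := isUnit_iff_ne_zero.2 hW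
  have hT : T = W * Mᵀ * W⁻¹ := by rw [← h, Matrix.mul_nonsing_inv_cancel_right _ _ hu]
  constructor
  · rw [hT, Matrix.trace_mul_comm, ← mul_assoc, Matrix.nonsing_inv_mul _ hu, one_mul,
      Matrix.trace_transpose]
  · have := congrArg Matrix.det h
    rw [Matrix.det_mul, Matrix.det_mul, Matrix.det_transpose, mul_comm] at this
    exact (mul_left_cancel₀ hW this).symm

/-- The monodromy group is generated by the monodromy matrices of generators of the
fundamental group. -/
theorem monodromyGroup_eq_closure (hS : IsOpen Sᶜ) (hp : AnalyticOnNhd ℂ p Sᶜ)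
    (hq : AnalyticOnNhd ℂ q Sᶜ) (hy : IsFundamentalSystem p q b y) {ι : Type*} {ℓ : ι → Path b b}
    {M : ι → GL (Fin 2) ℂ} (hM : ∀ i, IsMonodromyMatrix y (ℓ i) (M i))
    (hgen : Subgroup.closure (Set.range fun i => FundamentalGroup.fromPath ⟦ℓ i⟧) =
      (⊤ : Subgroup (FundamentalGroup ↥Sᶜ b))) :
    monodromyGroup b y = Subgroup.closure (Set.range M) := by
  have ha := differentiableOn_companion hp hq
  have hdet := hy.det_cauchyData_ne_zero hS hp hq
  have hu : IsUnit (cauchyData y b).det := isUnit_iff_ne_zero.2 hdet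
  set W := cauchyData y b
  have hcont : ∀ ℓ : Path b b, Continuous fun t => (ℓ t : ℂ) := fun ℓ => by fun_prop
  refine le_antisymm ?_ ?_
  · rw [monodromyGroup, Subgroup.closure_le]
    rintro N ⟨ℓ', hN⟩
    -- Induction over the generated subgroup: each class has a representative whose transport
    -- corresponds to an element of the closure.
    have key : ∀ g : FundamentalGroup ↥Sᶜ b, ∃ (p' : Path b b) (N : GL (Fin 2) ℂ)
        (T : Matrix (Fin 2) (Fin 2) ℂ), FundamentalGroup.fromPath ⟦p'⟧ = g ∧
        N ∈ Subgroup.closure (Set.range M) ∧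
        IsTransport (companion p q) (fun t => (p' t : ℂ)) T ∧ T * W = W * (N : Matrix _ _ ℂ)ᵀ := by
      intro g
      have hg : g ∈ Subgroup.closure (Set.range fun i => FundamentalGroup.fromPath ⟦ℓ i⟧) := by
        rw [hgen]; trivial
      induction hg using Subgroup.closure_induction with
      | mem g hg =>
        obtain ⟨i, rfl⟩ := hg
        obtain ⟨T, hT⟩ := IsTransport.exists_transport hS ha (hcont (ℓ i)) fun t => (ℓ i t).2
        exact ⟨ℓ i, M i, T, rfl, Subgroup.subset_closure ⟨i, rfl⟩, hT,
          (hM i).transport_mul hS hp hq hy hT⟩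
      | one =>
        exact ⟨Path.refl b, 1, 1, rfl, one_mem _, IsTransport.const hS ha b.2, by simp⟩
      | mul g g' _ _ ih ih' =>
        obtain ⟨p₁, N₁, T₁, h₁, hN₁, hT₁, e₁⟩ := ih
        obtain ⟨p₂, N₂, T₂, h₂, hN₂, hT₂, e₂⟩ := ih'
        -- The product `g * g'` runs through `g'` first. The transports multiply to `T₁ * T₂`, and
        -- transposition reverses this to `N₂ * N₁`.
        refine ⟨p₂.trans p₁, N₂ * N₁, T₁ * T₂, ?_, mul_mem hN₂ hN₁, hT₂.trans hS ha hT₁, ?_⟩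
        · rw [← h₁, ← h₂, FundamentalGroup.mul_def]; rfl
        · rw [mul_assoc, e₂, ← mul_assoc, e₁, Units.val_mul, Matrix.transpose_mul, mul_assoc]
      | inv g _ ih =>
        obtain ⟨p₁, N₁, T₁, h₁, hN₁, hT₁, e₁⟩ := ih
        obtain ⟨T, hT⟩ := IsTransport.exists_transport hS ha (hcont p₁.symm) fun t => (p₁.symm t).2
        refine ⟨p₁.symm, N₁⁻¹, T, ?_, inv_mem hN₁, hT, ?_⟩
        · rw [← h₁, FundamentalGroup.inv_def]; rfl
        · have h1 : T * T₁ = 1 := hT₁.symm_mul hT hS ha (hcont p₁) fun t => (p₁ t).2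
          have h2 : (N₁ : Matrix (Fin 2) (Fin 2) ℂ)ᵀ * ((N₁⁻¹ : GL (Fin 2) ℂ) : Matrix _ _ ℂ)ᵀ = 1 := by
            rw [← Matrix.transpose_mul, ← Units.val_mul, inv_mul_cancel, Units.val_one,
              Matrix.transpose_one]
          calc T * W = T * (W * (N₁ : Matrix (Fin 2) (Fin 2) ℂ)ᵀ) *
                ((N₁⁻¹ : GL (Fin 2) ℂ) : Matrix _ _ ℂ)ᵀ := by
                rw [mul_assoc, mul_assoc W, h2, mul_one]
            _ = _ := by rw [← e₁, ← mul_assoc, h1, one_mul]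
    obtain ⟨p', N', T, hp', hN', hT, e⟩ := key (FundamentalGroup.fromPath ⟦ℓ'⟧)
    have hhom : p'.Homotopic ℓ' := Quotient.exact hp'
    -- Transport depends only on the homotopy class, and `W` is invertible, so the given `N` must be
    -- the matrix `N'` already found.
    have e' : T * W = W * (N : Matrix (Fin 2) (Fin 2) ℂ)ᵀ := hN.transport_mul hS hp hq hy (hT.of_homotopic hS ha hhom)
    have : (N : Matrix (Fin 2) (Fin 2) ℂ)ᵀ = (N' : Matrix (Fin 2) (Fin 2) ℂ)ᵀ := by
      have := congrArg (W⁻¹ * ·) (e'.symm.trans e)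
      simpa only [← mul_assoc, Matrix.nonsing_inv_mul _ hu, one_mul] using this
    have : N = N' := Units.ext (Matrix.transpose_injective this)
    exact this ▸ hN'
  · rw [Subgroup.closure_le]
    rintro _ ⟨i, rfl⟩
    exact Subgroup.subset_closure ⟨ℓ i, hM i⟩

end Continuation

end SecondOrder

/-! ### Local monodromy from circles of varying radius. -/

section Circles

open Filter Metric

attribute [local instance] Matrix.linftyOpNormedRing Matrix.linftyOpNormedAlgebra

theorem IsHorizontal.hasDerivAt {𝔸 : Type*} [NormedRing 𝔸] [NormedAlgebra ℂ 𝔸] {a : ℂ → 𝔸}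
    {h : ℝ → ℂ} {W : ℝ → 𝔸} (hW : IsHorizontal a h W) {h' : ℂ} {θ : ℝ} (hh : HasDerivAt h h' θ) :
    HasDerivAt W (h' • (a (h θ) * W θ)) θ := by
  obtain ⟨Y, hY, hWY⟩ := hW θ
  rw [hWY.self_of_nhds]
  exact (hY.self_of_nhds.scomp θ hh).congr_of_eventuallyEq hWY

/-- If `Z' = i N Z` with `N` uniformly close to a constant `N₀`, then `Z` is close to the solution
of `E' = i N₀ E` with the same initial value. -/
theorem dist_le_of_perturbation {𝔸 : Type*} [NormedRing 𝔸] [NormedAlgebra ℂ 𝔸] (N₀ : 𝔸)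
    {E : ℝ → 𝔸} (hE : ∀ θ, HasDerivAt E (Complex.I • (N₀ * E θ)) θ) :
    ∃ C : ℝ, ∀ η : ℝ, 0 ≤ η → η ≤ 1 → ∀ (N Z : ℝ → 𝔸), (∀ θ, ‖N θ - N₀‖ ≤ η) →
      (∀ θ, HasDerivAt Z (Complex.I • (N θ * Z θ)) θ) → Z 0 = E 0 →
      dist (E (2 * Real.pi)) (Z (2 * Real.pi)) ≤ C * η := by
  have hEc : Continuous E := continuous_iff_continuousAt.2 fun θ => (hE θ).continuousAt
  obtain ⟨B, hB⟩ := (isCompact_Icc (a := (0 : ℝ)) (b := 2 * Real.pi)).exists_bound_of_continuousOn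
    hEc.continuousOn
  -- A Lipschitz constant common to all perturbations with `η ≤ 1`.
  set K : NNReal := ‖N₀‖₊ + 1 with hK
  have hKpos : (0 : ℝ) < K := by rw [hK]; positivity
  refine ⟨B / K * (Real.exp (K * (2 * Real.pi)) - 1), fun η hη0 hη1 N Z hN hZ h0 => ?_⟩
  have hZc : Continuous Z := continuous_iff_continuousAt.2 fun θ => (hZ θ).continuousAt
  have hLip : ∀ θ, LipschitzWith K fun X : 𝔸 => Complex.I • (N θ * X) := fun θ => by
    refine LipschitzWith.of_dist_le_mul fun X Y => ?_
    rw [dist_eq_norm, ← smul_sub, ← mul_sub, norm_smul, Complex.norm_I, one_mul, dist_eq_norm]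
    refine (norm_mul_le _ _).trans (mul_le_mul_of_nonneg_right ?_ (norm_nonneg _))
    calc ‖N θ‖ = ‖N₀ + (N θ - N₀)‖ := by rw [add_sub_cancel]
      _ ≤ ‖N₀‖ + ‖N θ - N₀‖ := norm_add_le _ _
      _ ≤ K := by rw [hK]; push_cast; linarith [hN θ, coe_nnnorm N₀]
  -- `E` solves the equation of `Z` up to an error `η * B`, where `B` bounds `E` on the period;
  -- Grönwall's bound is then linear in `η`.
  have key := dist_le_of_approx_trajectories_ODE (K := K) (δ := 0) (εf := η * B) (εg := 0)
    (v := fun θ X => Complex.I • (N θ * X)) (a := 0) (b := 2 * Real.pi) hLip hEc.continuousOn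
    (fun θ _ => (hE θ).hasDerivWithinAt) (fun θ hθ => ?_) hZc.continuousOn
    (fun θ _ => (hZ θ).hasDerivWithinAt) (fun θ _ => by simp) (by rw [h0, dist_self])
    (2 * Real.pi) ⟨by positivity, le_rfl⟩
  · refine key.trans (le_of_eq ?_)
    rw [gronwallBound_of_K_ne_0 hKpos.ne']
    simp only [add_zero, zero_mul, sub_zero, zero_add]
    ring
  · rw [dist_eq_norm, ← smul_sub, ← sub_mul, norm_smul, Complex.norm_I, one_mul]
    refine (norm_mul_le _ _).trans (mul_le_mul ?_ (hB θ ⟨hθ.1, hθ.2.le⟩) (norm_nonneg _) hη0)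
    rw [norm_sub_rev]
    exact hN θ

/-- The solution of the Euler system with exponents `u`, `v`. -/
theorem exists_euler_solution (u v : ℂ) : ∃ E : ℝ → Matrix (Fin 2) (Fin 2) ℂ,
    (∀ θ, HasDerivAt E (Complex.I • (!![u, 1; 0, v] * E θ)) θ) ∧ E 0 = 1 ∧
    ∀ θ, (E θ).trace = Complex.exp (Complex.I * θ * u) + Complex.exp (Complex.I * θ * v) ∧
      (E θ).det = Complex.exp (Complex.I * θ * u) * Complex.exp (Complex.I * θ * v) := by
  have hexp : ∀ (w : ℂ) (θ : ℝ), HasDerivAt (fun θ : ℝ => Complex.exp (Complex.I * θ * w))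
      (Complex.I * w * Complex.exp (Complex.I * θ * w)) θ := fun w θ => by
    have h1 : HasDerivAt (fun θ : ℝ => Complex.I * (θ : ℂ) * w) (Complex.I * 1 * w) θ :=
      ((Complex.ofRealCLM.hasDerivAt (x := θ)).const_mul Complex.I).mul_const w
    convert! h1.cexp using 1
    ring
  -- The off-diagonal entry. For `u = v` the forcing term is resonant and a factor `θ` appears, the
  -- logarithm of the Frobenius method; trace and determinant do not see it.
  obtain ⟨f, hf, hf0⟩ : ∃ f : ℝ → ℂ, (∀ θ, HasDerivAt f
      (Complex.I * (u * f θ + Complex.exp (Complex.I * θ * v))) θ) ∧ f 0 = 0 := by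
    by_cases huv : v = u
    · subst huv
      refine ⟨fun θ => Complex.I * θ * Complex.exp (Complex.I * θ * v), fun θ => ?_, by simp⟩
      have h1 : HasDerivAt (fun θ : ℝ => Complex.I * (θ : ℂ)) (Complex.I * 1) θ :=
        (Complex.ofRealCLM.hasDerivAt (x := θ)).const_mul Complex.I
      convert! h1.mul (hexp v θ) using 1
      ring
    · have h := sub_ne_zero.2 huv
      refine ⟨fun θ => (Complex.exp (Complex.I * θ * v) - Complex.exp (Complex.I * θ * u)) / (v - u),
        fun θ => ?_, by simp⟩
      convert! ((hexp v θ).sub (hexp u θ)).div_const (v - u) using 1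
      field_simp
      ring
  refine ⟨fun θ => !![Complex.exp (Complex.I * θ * u), f θ; 0, Complex.exp (Complex.I * θ * v)],
    fun θ => hasDerivAt_matrix.2 fun i j => ?_, ?_, fun θ => ⟨?_, ?_⟩⟩
  · fin_cases i <;> fin_cases j
    · simpa [mul_assoc] using hexp u θ
    · simpa using hf θ
    · simpa using hasDerivAt_const θ (0 : ℂ)
    · simpa [mul_assoc] using hexp v θ
  · ext i j
    fin_cases i <;> fin_cases j <;> simp [hf0]
  · simp [Matrix.trace_fin_two]
  · simp [Matrix.det_fin_two]

variable {p q : ℂ → ℂ}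

/-- The coefficient matrix of the system for `(y, ζ y' - u y)`, where `ζ` is the local coordinate
and `x = ζ p`, `w = ζ² q`. -/
def eulerMatrix (u x w : ℂ) : Matrix (Fin 2) (Fin 2) ℂ :=
  !![u, 1; u * (1 - u - x) - w, 1 - u - x]

/-- The gauge `G` sends `(y, y')` to `(y, ζ y' - u y)`. It is `2π`-periodic along the circle, so the
monodromy changes only by conjugation with `G 0`. -/
theorem exists_circle_solution {U : Set ℂ} (hU : IsOpen U)
    (ha : DifferentiableOn ℂ (companion p q) U) {c : ℂ} {r : ℝ} (hr : 0 < r)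
    (hcirc : ∀ θ, circleMap c r θ ∈ U) {T : Matrix (Fin 2) (Fin 2) ℂ}
    (hT : IsTransport (companion p q) (fun t : I => circleMap c r (2 * Real.pi * t)) T) (u : ℂ) :
    ∃ Z : ℝ → Matrix (Fin 2) (Fin 2) ℂ, Z 0 = 1 ∧
      (∀ θ, HasDerivAt Z (Complex.I • (eulerMatrix u (circleMap 0 r θ * p (circleMap c r θ))
        (circleMap 0 r θ ^ 2 * q (circleMap c r θ)) * Z θ)) θ) ∧
      (Z (2 * Real.pi)).trace = T.trace ∧ (Z (2 * Real.pi)).det = T.det := by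
  have hcont : Continuous (circleMap c r) := continuous_circleMap c r
  obtain ⟨W, hW, hW0⟩ := IsHorizontal.exists_lift hU ha hcont hcirc 0 1
  have hWT : W (2 * Real.pi) = T := by
    have := hT.apply_one_eq hU ha (by fun_prop) (fun t => hcirc _)
      (hW.comp (g := fun t : I => 2 * Real.pi * (t : ℝ)) (by fun_prop))
    simpa [hW0] using this
  let G : ℝ → Matrix (Fin 2) (Fin 2) ℂ := fun θ => !![1, 0; -u, circleMap 0 r θ]
  have hG : ∀ θ, HasDerivAt G !![0, 0; 0, circleMap 0 r θ * Complex.I] θ := fun θ => by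
    refine hasDerivAt_matrix.2 fun i j => ?_
    fin_cases i <;> fin_cases j
    · exact hasDerivAt_const θ (1 : ℂ)
    · exact hasDerivAt_const θ (0 : ℂ)
    · exact hasDerivAt_const θ (-u)
    · exact hasDerivAt_circleMap 0 r θ
  have hdet : IsUnit (G 0).det := by
    simp [G, Matrix.det_fin_two, circleMap, hr.ne']
  have hper : G (2 * Real.pi) = G 0 := by simp [G, circleMap]
  refine ⟨fun θ => G θ * W θ * (G 0)⁻¹, ?_, fun θ => ?_, ?_, ?_⟩
  · beta_reduce
    rw [hW0, mul_one, Matrix.mul_nonsing_inv _ hdet]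
  · have h1 := ((hG θ).mul (hW.hasDerivAt (hasDerivAt_circleMap c r θ))).mul_const (G 0)⁻¹
    convert! h1 using 1
    rw [← mul_assoc, ← Matrix.smul_mul]
    congr 1
    rw [Matrix.mul_smul, ← mul_assoc, ← mul_assoc, ← Matrix.smul_mul,
      ← Matrix.smul_mul _ (G θ * companion p q _), ← add_mul]
    congr 1
    ext i j
    fin_cases i <;> fin_cases j <;> simp [G, eulerMatrix, companion] <;> ring
  · beta_reduce
    rw [hWT, hper, Matrix.trace_mul_comm, ← mul_assoc, Matrix.nonsing_inv_mul _ hdet, one_mul]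
  · beta_reduce
    rw [hWT, hper, Matrix.det_mul, Matrix.det_mul, Matrix.det_nonsing_inv, mul_right_comm,
      Ring.mul_inverse_cancel _ hdet, one_mul]

theorem trace_det_of_conj {S T₀ T₁ : Matrix (Fin 2) (Fin 2) ℂ} (hS : IsUnit S)
    (h : T₁ * S = S * T₀) : T₁.trace = T₀.trace ∧ T₁.det = T₀.det := by
  have := trace_det_of_transport (T := T₁) (W := S) (M := T₀ᵀ)
    ((Matrix.isUnit_iff_isUnit_det S).1 hS).ne_zero (by rw [Matrix.transpose_transpose, h])
  rw [Matrix.trace_transpose, Matrix.det_transpose] at this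
  exact ⟨this.1.symm, this.2.symm⟩

/-- Trace and determinant of the monodromy around a regular singular point (finite or infinite)
with exponents `u`, `v`, obtained by letting the radius of the circle tend to its limit. -/
theorem trace_det_of_freelyHomotopicToCircle {S : Set ℂ} (hS : IsOpen Sᶜ)
    (hp : AnalyticOnNhd ℂ p Sᶜ) (hq : AnalyticOnNhd ℂ q Sᶜ) {b : ↥Sᶜ} {ℓ : Path b b} {c : ℂ} {r : ℝ}
    (hℓ : FreelyHomotopicToCircle ℓ c r) {l : Filter ℝ} [l.NeBot] {J : Set ℝ} (hJ : J.OrdConnected)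
    (hJl : J ∈ l) (hrJ : r ∈ J) (hJS : ∀ r ∈ J, 0 < r ∧ ∀ z, ‖z - c‖ = r → z ∈ Sᶜ) {u v : ℂ}
    (hp0 : Tendsto (fun z => (z - c) * p z) (comap (fun z => ‖z - c‖) l) (𝓝 (1 - u - v)))
    (hq0 : Tendsto (fun z => (z - c) ^ 2 * q z) (comap (fun z => ‖z - c‖) l) (𝓝 (u * v)))
    {T : Matrix (Fin 2) (Fin 2) ℂ} (hT : IsTransport (companion p q) (fun t => (ℓ t : ℂ)) T) :
    T.trace = Complex.exp (2 * Real.pi * Complex.I * u) + Complex.exp (2 * Real.pi * Complex.I * v) ∧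
    T.det = Complex.exp (2 * Real.pi * Complex.I * u) * Complex.exp (2 * Real.pi * Complex.I * v) := by
  have ha := differentiableOn_companion hp hq
  have hcirc : ∀ r ∈ J, ∀ θ, circleMap c r θ ∈ Sᶜ := fun r hr θ =>
    (hJS r hr).2 _ (by simp [circleMap, abs_of_pos (hJS r hr).1])
  -- Concentric circles with radii in the interval `J` are freely homotopic, so all have the trace
  -- and determinant of `T`.
  have hTr : ∀ s ∈ J, ∃ T', IsTransport (companion p q)
      (fun t : I => circleMap c s (2 * Real.pi * t)) T' ∧ T'.trace = T.trace ∧ T'.det = T.det := by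
    intro s hs
    obtain ⟨T₁, hT₁⟩ := IsTransport.exists_transport hS ha
      (h := fun t : I => circleMap c r (2 * Real.pi * t)) (by fun_prop) fun t => hcirc r hrJ _
    obtain ⟨T₂, hT₂⟩ := IsTransport.exists_transport hS ha
      (h := fun t : I => circleMap c s (2 * Real.pi * t)) (by fun_prop) fun t => hcirc s hs _
    obtain ⟨H, H0, H1, Hc⟩ := hℓ
    obtain ⟨R, hR, e⟩ := IsTransport.conj_of_freeHomotopy (H := fun z => (H z : ℂ)) (by fun_prop)
      (fun z => (H z).2) (fun s => by rw [Hc]) hS ha (by simpa only [H0] using hT)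
      (by simpa only [H1] using hT₁)
    have t1 := trace_det_of_conj (hR.isUnit hS ha (by fun_prop) fun z => (H _).2) e
    let ρ : I → ℝ := fun x => r + x * (s - r)
    have hρJ : ∀ x, ρ x ∈ J := fun x => by
      refine hJ.uIcc_subset hrJ hs ?_
      rw [Set.mem_uIcc]
      have h0 := x.2.1
      have h1 := x.2.2
      rcases le_total r s with h | h
      · left; constructor <;> simp only [ρ] <;> nlinarith
      · right; constructor <;> simp only [ρ] <;> nlinarith
    have hHc : Continuous fun z : I × I => circleMap c (ρ z.1) (2 * Real.pi * z.2) := by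
      simp only [circleMap, ρ]; fun_prop
    obtain ⟨R', hR', e'⟩ := IsTransport.conj_of_freeHomotopy
      (H := fun z => circleMap c (ρ z.1) (2 * Real.pi * z.2)) hHc (fun z => hcirc _ (hρJ _) _)
      (fun x => by simp [circleMap]) hS ha (by simpa [ρ] using hT₁) (by simpa [ρ] using hT₂)
    have t2 := trace_det_of_conj (hR'.isUnit hS ha (by fun_prop) fun z => hcirc _ (hρJ _) _) e'
    exact ⟨T₂, hT₂, t2.1.trans t1.1, t2.2.trans t1.2⟩
  obtain ⟨E, hE, hE0, hEtd⟩ := exists_euler_solution u v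
  obtain ⟨C, hC⟩ := dist_le_of_perturbation _ hE
  have hlim : Tendsto (fun z => eulerMatrix u ((z - c) * p z) ((z - c) ^ 2 * q z))
      (comap (fun z => ‖z - c‖) l) (𝓝 !![u, 1; 0, v]) := by
    have hcont : Continuous fun x : ℂ × ℂ => eulerMatrix u x.1 x.2 := by
      unfold eulerMatrix
      refine continuous_matrix fun i j => ?_
      fin_cases i <;> fin_cases j <;> simp <;> fun_prop
    have := (hcont.tendsto (1 - u - v, u * v)).comp (hp0.prodMk_nhds hq0)
    convert! this using 2
    simp only [eulerMatrix]
    ext i j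
    fin_cases i <;> fin_cases j <;> simp
  -- The transports over the circles are known only up to conjugation, so the limit is taken in the
  -- closed set of matrices with the trace and determinant of `T`.
  have hmem : E (2 * Real.pi) ∈ closure {X : Matrix (Fin 2) (Fin 2) ℂ | X.trace = T.trace ∧
      X.det = T.det} := by
    refine Metric.mem_closure_iff.2 fun ε hε => ?_
    obtain ⟨η, hη, hη1, hηε⟩ : ∃ η : ℝ, 0 < η ∧ η ≤ 1 ∧ C * η < ε := by
      refine ⟨min 1 (ε / (2 * (|C| + 1))), by positivity, min_le_left _ _, ?_⟩
      calc C * min 1 (ε / (2 * (|C| + 1))) ≤ (|C| + 1) * (ε / (2 * (|C| + 1))) :=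
            mul_le_mul (by linarith [le_abs_self C]) (min_le_right _ _) (by positivity) (by positivity)
        _ = ε / 2 := by field_simp
        _ < ε := by linarith
    have hev := hlim.eventually (Metric.closedBall_mem_nhds _ hη)
    obtain ⟨V, hV, hVη⟩ := Filter.mem_comap.1 hev
    obtain ⟨s, hsV, hsJ⟩ := (l.nonempty_of_mem (inter_mem hV hJl))
    obtain ⟨T', hT', ht, hd⟩ := hTr s hsJ
    obtain ⟨Z, hZ0, hZ, hZt, hZd⟩ := exists_circle_solution hS ha (hJS s hsJ).1 (hcirc s hsJ) hT' u
    refine ⟨Z (2 * Real.pi), ⟨hZt.trans ht, hZd.trans hd⟩, ?_⟩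
    refine lt_of_le_of_lt (hC η hη.le hη1 _ Z (fun θ => ?_) hZ (by rw [hZ0, hE0])) hηε
    have := hVη (show circleMap c s θ ∈ (fun z => ‖z - c‖) ⁻¹' V by
      simpa [circleMap, abs_of_pos (hJS s hsJ).1] using hsV)
    simpa [circleMap, dist_eq_norm] using this
  have hclosed : IsClosed {X : Matrix (Fin 2) (Fin 2) ℂ | X.trace = T.trace ∧ X.det = T.det} :=
    (isClosed_eq (Continuous.matrix_trace continuous_id) continuous_const).inter
      (isClosed_eq (Continuous.matrix_det continuous_id) continuous_const)
  rw [hclosed.closure_eq] at hmem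
  obtain ⟨h1, h2⟩ := hEtd (2 * Real.pi)
  rw [← hmem.1, ← hmem.2, h1, h2]
  push_cast
  constructor <;> ring_nf

end Circles

/-! ### Real algebras of complex `2 × 2` matrices. -/

section TwoByTwo

open Matrix

/-- Complex `2 × 2` matrices. -/
abbrev Mat2 := Matrix (Fin 2) (Fin 2) ℂ

theorem mul_self_eq (X : Mat2) : X * X = X.trace • X - X.det • 1 := by
  ext i j
  fin_cases i <;> fin_cases j <;>
    simp [Matrix.mul_apply, Matrix.trace_fin_two, Matrix.det_fin_two] <;> ring

/-- Polarised Cayley–Hamilton: it allows words in the generators to be reordered modulo shorter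
ones. -/
theorem mul_add_mul_swap (X Y : Mat2) : Y * X =
    -(X * Y) + Y.trace • X + X.trace • Y + ((X * Y).trace - X.trace * Y.trace) • 1 := by
  ext i j
  fin_cases i <;> fin_cases j <;> simp [Matrix.mul_apply, Matrix.trace_fin_two] <;> ring

/-- For invertible `X` this is Cayley–Hamilton for `N * X` times `X⁻¹`. It makes `N * X * N` vanish
when `N` is singular and trace-orthogonal to `X`. -/
theorem mul_mul_self_eq (N X : Mat2) : N * X * N = (N * X).trace • N - N.det • X.adjugate := by
  ext i j
  fin_cases i <;> fin_cases j <;>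
    simp [Matrix.mul_apply, Matrix.trace_fin_two, Matrix.det_fin_two, Matrix.adjugate_fin_two] <;> ring

/-- Fricke's relation. Given real shorter traces, it makes the two cyclic orders of the triple
product interchangeable. -/
theorem trace_mul_mul_add (X Y Z : Mat2) : (X * Y * Z).trace + (X * Z * Y).trace =
    X.trace * (Y * Z).trace + Y.trace * (X * Z).trace + Z.trace * (X * Y).trace
      - X.trace * Y.trace * Z.trace := by
  simp [Matrix.mul_apply, Matrix.trace_fin_two, Fin.sum_univ_two]; ring

theorem adjugate_eq (X : Mat2) : X.adjugate = X.trace • 1 - X := by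
  ext i j
  fin_cases i <;> fin_cases j <;> simp [Matrix.trace_fin_two, Matrix.adjugate_fin_two]

theorem adjugate_add_two (X Y : Mat2) : (X + Y).adjugate = X.adjugate + Y.adjugate := by
  rw [adjugate_eq, adjugate_eq, adjugate_eq, Matrix.trace_add]; module

/-- Two vectors in the kernel of a nonzero matrix are proportional. -/
theorem exists_smul_of_mulVec_eq_zero {N : Mat2} (hN : N ≠ 0) {v w : Fin 2 → ℂ} (hv : v ≠ 0)
    (hNv : N *ᵥ v = 0) (hNw : N *ᵥ w = 0) : ∃ c : ℂ, w = c • v := by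
  have hdet : (!![v 0, w 0; v 1, w 1] : Mat2).det = 0 := by
    by_contra hd
    have h0 : N * !![v 0, w 0; v 1, w 1] = 0 := by
      have e0 := congrFun hNv
      have e1 := congrFun hNw
      simp only [Matrix.mulVec, dotProduct, Fin.sum_univ_two, Pi.zero_apply] at e0 e1
      ext i j
      fin_cases j
      · simpa [Matrix.mul_apply] using e0 i
      · simpa [Matrix.mul_apply] using e1 i
    have := congrArg (· * (!![v 0, w 0; v 1, w 1] : Mat2)⁻¹) h0
    simp only [zero_mul, Matrix.mul_nonsing_inv_cancel_right _ _ (isUnit_iff_ne_zero.2 hd)] at this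
    exact hN this
  rw [Matrix.det_fin_two_of] at hdet
  by_cases h : v 0 = 0
  · have h1 : v 1 ≠ 0 := fun h1 => hv (funext (Fin.forall_fin_two.2 ⟨h, h1⟩))
    refine ⟨w 1 / v 1, funext (Fin.forall_fin_two.2 ⟨?_, ?_⟩)⟩
    · have : w 0 * v 1 = 0 := by rw [h] at hdet; linear_combination -hdet
      simp [h, (mul_eq_zero.1 this).resolve_right h1]
    · simp [h1]
  · refine ⟨w 0 / v 0, funext (Fin.forall_fin_two.2 ⟨?_, ?_⟩)⟩
    · simp [h]
    · simp only [Pi.smul_apply, smul_eq_mul]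
      field_simp
      linear_combination hdet

/-- The matrices in `A` have no common eigenvector. -/
def NoCommonEigenvector (A : Set Mat2) : Prop :=
  ∀ v : Fin 2 → ℂ, v ≠ 0 → ∃ X ∈ A, ∀ c : ℂ, X *ᵥ v ≠ c • v

/-- Burnside's theorem for `2 × 2` matrices. -/
theorem span_eq_top_of_noCommonEigenvector {A : Subalgebra ℝ Mat2}
    (hA : NoCommonEigenvector (A : Set Mat2)) : Submodule.span ℂ (A : Set Mat2) = ⊤ := by
  by_contra hne
  obtain ⟨f, hf, hker⟩ := Submodule.exists_le_ker_of_lt_top _ (lt_top_iff_ne_top.2 hne)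
  set N : Mat2 := Matrix.of fun i j => f (Matrix.single j i 1) with hNdef
  have hfN : ∀ X, f X = (N * X).trace := fun X => by
    conv_lhs => rw [Matrix.matrix_eq_sum_single X]
    have hs : ∀ i j, f (Matrix.single i j (X i j)) = X i j * f (Matrix.single i j 1) := fun i j => by
      rw [← smul_eq_mul, ← map_smul, Matrix.smul_single, smul_eq_mul, mul_one]
    simp only [map_sum, hs]
    simp [hNdef, Matrix.trace_fin_two, Matrix.mul_apply, Fin.sum_univ_two]
    ring
  have hN0 : N ≠ 0 := fun h => hf (LinearMap.ext fun X => by rw [hfN, h]; simp)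
  have horth : ∀ X ∈ A, (N * X).trace = 0 := fun X hX => by
    rw [← hfN]; exact hker (Submodule.subset_span hX)
  -- For such `N`, all of `N * X * N` vanish. Taking `X = 1` shows that the image of `N` lies in its
  -- kernel, which is a line; each `X` maps the image into this line, so it is a common eigenline.
  have singular : ∀ N : Mat2, N ≠ 0 → N.det = 0 → (∀ X ∈ A, (N * X).trace = 0) → False := by
    intro N hN0 hdet horth
    have hNXN : ∀ X ∈ A, N * X * N = 0 := fun X hX => by
      rw [mul_mul_self_eq, horth X hX, hdet]; simp
    obtain ⟨u, hu⟩ : ∃ u, N *ᵥ u ≠ 0 := by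
      by_contra! h
      exact hN0 (Matrix.ext_of_mulVec_single fun i => by rw [h, Matrix.zero_mulVec])
    obtain ⟨X, hX, hXv⟩ := hA _ hu
    have h1 := congrArg (· *ᵥ u) (hNXN 1 A.one_mem)
    have h2 := congrArg (· *ᵥ u) (hNXN X hX)
    simp only [mul_one, ← Matrix.mulVec_mulVec, Matrix.zero_mulVec] at h1 h2
    obtain ⟨c, hc⟩ := exists_smul_of_mulVec_eq_zero hN0 hu h1 h2
    exact hXv c hc
  by_cases hdet : N.det = 0
  · exact singular N hN0 hdet horth
  -- For invertible `N`, pick a nonscalar `X ∈ A` with eigenvalue `c`: then `N * (X - c)` is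
  -- nonzero, singular and still orthogonal to `A`.
  · obtain ⟨X, hX, hXv⟩ := hA (Pi.single 0 1) (by simp)
    obtain ⟨c, hc⟩ := IsAlgClosed.exists_root (X.charpoly) (by
      rw [Matrix.charpoly_degree_eq_dim]; simp)
    have hdet' : (X - c • 1).det = 0 := by
      have : (Polynomial.eval c X.charpoly) = 0 := hc
      rw [Matrix.eval_charpoly] at this
      rw [← neg_sub, Matrix.det_neg, show (c • 1 : Mat2) = Matrix.scalar (Fin 2) c by
        simp [Matrix.smul_one_eq_diagonal], this, mul_zero]
    refine singular (N * (X - c • 1)) (fun h0 => ?_) (by rw [Matrix.det_mul, hdet', mul_zero])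
      fun Y hY => ?_
    · have := congrArg (N⁻¹ * ·) h0
      simp only [mul_zero, Matrix.nonsing_inv_mul_cancel_left _ _ (isUnit_iff_ne_zero.2 hdet)] at this
      exact hXv c (by rw [sub_eq_zero.1 this, Matrix.smul_mulVec, Matrix.one_mulVec])
    · rw [mul_assoc, sub_mul, mul_sub, Matrix.trace_sub, horth _ (A.mul_mem hX hY)]
      simp [horth Y hY]

section RealForm

variable {A : Subalgebra ℝ Mat2}

theorem exists_add_I_smul (hA : Submodule.span ℂ (A : Set Mat2) = ⊤) (X : Mat2) :
    ∃ Y ∈ A, ∃ Z ∈ A, X = Y + Complex.I • Z := by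
  have hX : X ∈ Submodule.span ℂ (A : Set Mat2) := hA ▸ trivial
  induction hX using Submodule.span_induction with
  | mem X hX => exact ⟨X, hX, 0, A.zero_mem, by simp⟩
  | zero => exact ⟨0, A.zero_mem, 0, A.zero_mem, by simp⟩
  | add X X' _ _ h h' =>
    obtain ⟨Y, hY, Z, hZ, rfl⟩ := h
    obtain ⟨Y', hY', Z', hZ', rfl⟩ := h'
    exact ⟨Y + Y', A.add_mem hY hY', Z + Z', A.add_mem hZ hZ', by module⟩
  | smul c X _ h =>
    obtain ⟨Y, hY, Z, hZ, rfl⟩ := h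
    refine ⟨c.re • Y - c.im • Z, A.sub_mem (A.smul_mem hY _) (A.smul_mem hZ _),
      c.im • Y + c.re • Z, A.add_mem (A.smul_mem hY _) (A.smul_mem hZ _), ?_⟩
    ext i j
    simp only [Matrix.smul_apply, Matrix.add_apply, Matrix.sub_apply, Complex.real_smul, smul_eq_mul]
    conv_lhs => rw [← Complex.re_add_im c]
    linear_combination (c.im * Z i j : ℂ) * Complex.I_sq

/-- `A` contains no complex line. -/
def IsTotallyReal (A : Subalgebra ℝ Mat2) : Prop := ∀ X ∈ A, Complex.I • X ∈ A → X = 0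

/-- If `X` and `iX` lie in `A`, then `tr (X Y)` and `i tr (X Y)` are both real for `Y ∈ A`, hence
zero; the trace form is nondegenerate on the complex span. -/
theorem isTotallyReal_of_trace (hA : Submodule.span ℂ (A : Set Mat2) = ⊤)
    (htr : ∀ X ∈ A, X.trace.im = 0) : IsTotallyReal A := by
  intro X hX hIX
  have h0 : ∀ Y ∈ A, (X * Y).trace = 0 := fun Y hY => by
    have h1 := htr _ (A.mul_mem hX hY)
    have h2 := htr _ (A.mul_mem hIX hY)
    simp only [Matrix.smul_mul, Matrix.trace_smul, smul_eq_mul, Complex.mul_im, Complex.I_re,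
      Complex.I_im, zero_mul, one_mul, zero_add] at h2
    exact Complex.ext h2 h1
  have h1 : ∀ Y, (X * Y).trace = 0 := fun Y => by
    obtain ⟨Y, hY, Z, hZ, rfl⟩ := exists_add_I_smul hA Y
    rw [mul_add, Matrix.mul_smul, Matrix.trace_add, Matrix.trace_smul, h0 Y hY, h0 Z hZ]; simp
  ext i j
  have := h1 (Matrix.single j i 1)
  simpa [Matrix.trace_mul_single] using this

/-- Cayley–Hamilton gives `i (Im t · X - Im d) = X² - Re t · X + Re d ∈ A`, so `Im t · X = Im d`. If
`Im t ≠ 0`, then `X` is a real scalar, whose trace is real. -/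
theorem IsTotallyReal.trace_im (hA : IsTotallyReal A) {X : Mat2} (hX : X ∈ A) :
    X.trace.im = 0 := by
  by_contra ht
  set t := X.trace
  set d := X.det
  have hCH := mul_self_eq X
  have hmem : t.im • X - d.im • (1 : Mat2) ∈ A :=
    A.sub_mem (A.smul_mem hX _) (A.smul_mem A.one_mem _)
  have hI : Complex.I • (t.im • X - d.im • (1 : Mat2)) = X * X - t.re • X + d.re • 1 := by
    rw [hCH]
    ext i j
    simp only [Matrix.smul_apply, Matrix.add_apply, Matrix.sub_apply, Complex.real_smul, smul_eq_mul]
    change _ = t * X i j - d * _ - _ + _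
    linear_combination X i j * Complex.re_add_im t - (1 : Mat2) i j * Complex.re_add_im d
  have h0 := hA _ hmem (hI ▸ A.add_mem (A.sub_mem (A.mul_mem hX hX) (A.smul_mem hX _))
    (A.smul_mem A.one_mem _))
  have hXs : X = (d.im / t.im) • (1 : Mat2) := by
    have := congrArg (t.im⁻¹ • ·) (sub_eq_zero.1 h0)
    simpa [smul_smul, ht, div_eq_inv_mul] using this
  apply ht
  change X.trace.im = 0
  rw [hXs, Matrix.trace_smul]
  simp

/-- `A + iA` is everything, of real dimension 8, and `iA` has the dimension of `A`; so dimension 4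
means `A ∩ iA = 0`. -/
theorem finrank_eq_four_iff (hA : Submodule.span ℂ (A : Set Mat2) = ⊤) :
    Module.finrank ℝ A = 4 ↔ IsTotallyReal A := by
  let J : Mat2 ≃ₗ[ℝ] Mat2 :=
    (LinearEquiv.smulOfNeZero ℂ Mat2 Complex.I Complex.I_ne_zero).restrictScalars ℝ
  have hJ : ∀ X, J X = Complex.I • X := fun X => rfl
  let V : Submodule ℝ Mat2 := Subalgebra.toSubmodule A
  have hV : ∀ X, X ∈ V ↔ X ∈ A := fun X => Iff.rfl
  have h1 := Submodule.finrank_sup_add_finrank_inf_eq V (V.map (J : Mat2 →ₗ[ℝ] Mat2))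
  have hsup : V ⊔ V.map (J : Mat2 →ₗ[ℝ] Mat2) = ⊤ := by
    refine eq_top_iff.2 fun X _ => ?_
    obtain ⟨Y, hY, Z, hZ, rfl⟩ := exists_add_I_smul hA X
    exact Submodule.add_mem_sup hY ⟨Z, hZ, rfl⟩
  have h8 : Module.finrank ℝ Mat2 = 8 := by
    rw [← Module.finrank_mul_finrank ℝ ℂ Mat2, Complex.finrank_real_complex, Module.finrank_matrix]
    simp
  have hmap : Module.finrank ℝ (V.map (J : Mat2 →ₗ[ℝ] Mat2)) = Module.finrank ℝ V :=
    J.finrank_map_eq V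
  rw [hsup, finrank_top, h8, hmap] at h1
  have hfin : Module.finrank ℝ A = Module.finrank ℝ V := rfl
  have h2 : Module.finrank ℝ A = 4 ↔
      Module.finrank ℝ ↥(V ⊓ V.map (J : Mat2 →ₗ[ℝ] Mat2)) = 0 := by omega
  rw [h2, Submodule.finrank_eq_zero, Submodule.eq_bot_iff]
  constructor
  · intro h X hX hIX
    have := h (Complex.I • X) ⟨hIX, X, hX, rfl⟩
    exact (smul_eq_zero.1 this).resolve_left Complex.I_ne_zero
  · rintro h _ ⟨hX, Y, hY, rfl⟩
    have := h Y hY hX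
    rw [this, map_zero]

end RealForm

end TwoByTwo

/-! ### Invariant Hermitian forms and real traces. -/

section Hermitian

open Matrix

/-- An algebra generated by three elements that are quadratic and pairwise anticommute modulo
lower terms is spanned by the eight ordered monomials. -/
theorem adjoin_le_span_monomials {R : Type*} [Ring R] [Algebra ℝ R] {X Y Z : R}
    {x x' y y' z z' a₁ a₂ a₃ b₁ b₂ b₃ c₁ c₂ c₃ : ℝ}
    (hX : X * X = x • X + x' • 1) (hY : Y * Y = y • Y + y' • 1) (hZ : Z * Z = z • Z + z' • 1)
    (hYX : Y * X = -(X * Y) + a₁ • X + a₂ • Y + a₃ • 1)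
    (hZX : Z * X = -(X * Z) + b₁ • X + b₂ • Z + b₃ • 1)
    (hZY : Z * Y = -(Y * Z) + c₁ • Y + c₂ • Z + c₃ • 1) {W : R}
    (hW : W ∈ Algebra.adjoin ℝ {X, Y, Z}) :
    W ∈ Submodule.span ℝ {1, X, Y, Z, X * Y, X * Z, Y * Z, X * (Y * Z)} := by
  set V : Submodule ℝ R := Submodule.span ℝ {1, X, Y, Z, X * Y, X * Z, Y * Z, X * (Y * Z)} with hV
  have m : ∀ w ∈ ({1, X, Y, Z, X * Y, X * Z, Y * Z, X * (Y * Z)} : Set R), w ∈ V := fun w hw =>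
    Submodule.subset_span hw
  have h1 : 1 ∈ V := m _ (by simp)
  have hx : X ∈ V := m _ (by simp)
  have hy : Y ∈ V := m _ (by simp)
  have hz : Z ∈ V := m _ (by simp)
  have hxy : X * Y ∈ V := m _ (by simp)
  have hxz : X * Z ∈ V := m _ (by simp)
  have hyz : Y * Z ∈ V := m _ (by simp)
  have hxyz : X * (Y * Z) ∈ V := m _ (by simp)
  have hX' : ∀ w, X * (X * w) = x • (X * w) + x' • w := fun w => by
    rw [← mul_assoc, hX]; simp [add_mul]
  have hY' : ∀ w, Y * (Y * w) = y • (Y * w) + y' • w := fun w => by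
    rw [← mul_assoc, hY]; simp [add_mul]
  have hYX' : ∀ w, Y * (X * w) = -(X * (Y * w)) + a₁ • (X * w) + a₂ • (Y * w) + a₃ • w := fun w => by
    rw [← mul_assoc, hYX]; simp [add_mul, mul_assoc]
  have hZX' : ∀ w, Z * (X * w) = -(X * (Z * w)) + b₁ • (X * w) + b₂ • (Z * w) + b₃ • w := fun w => by
    rw [← mul_assoc, hZX]; simp [add_mul, mul_assoc]
  have hZY' : ∀ w, Z * (Y * w) = -(Y * (Z * w)) + c₁ • (Y * w) + c₂ • (Z * w) + c₃ • w := fun w => by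
    rw [← mul_assoc, hZY]; simp [add_mul, mul_assoc]
  -- A span containing `1` and stable under left multiplication by the generators contains every
  -- word in them.
  have hmul : ∀ g ∈ ({X, Y, Z} : Set R), ∀ w ∈ V, g * w ∈ V := by
    intro g hg w hw
    induction hw using Submodule.span_induction with
    | zero => rw [mul_zero]; exact V.zero_mem
    | add u v _ _ hu hv => rw [mul_add]; exact V.add_mem hu hv
    | smul c u _ hu => rw [mul_smul_comm]; exact V.smul_mem c hu
    | mem w hw =>
      rcases hg with rfl | rfl | rfl <;> rcases hw with rfl | rfl | rfl | rfl | rfl | rfl | rfl | rfl <;>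
        (try simp only [mul_one, hX, hY, hZ, hYX, hZX, hZY, hX', hY', hYX', hZX', hZY', mul_add,
          mul_neg, mul_smul_comm]) <;>
        repeat first
          | assumption
          | apply V.add_mem
          | apply V.smul_mem
          | apply V.neg_mem
  rw [← Subalgebra.mem_toSubmodule, Algebra.adjoin_eq_span] at hW
  refine Submodule.span_le.2 (fun w hw => ?_) hW
  induction hw using Submonoid.closure_induction_left with
  | one => exact h1
  | mul_left g hg w _ ih => exact hmul g hg w ih

/-- In the real algebra generated by three unimodular matrices, all traces are real as soon as
the traces of the ordered products of the generators are. -/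
theorem trace_im_eq_zero_of_mem_adjoin {X Y Z : Mat2} (hX : X.det = 1) (hY : Y.det = 1)
    (hZ : Z.det = 1) (tX : X.trace.im = 0) (tY : Y.trace.im = 0) (tZ : Z.trace.im = 0)
    (tXY : (X * Y).trace.im = 0) (tYZ : (Y * Z).trace.im = 0) (tXZ : (X * Z).trace.im = 0)
    (tXYZ : (X * (Y * Z)).trace.im = 0) {W : Mat2} (hW : W ∈ Algebra.adjoin ℝ {X, Y, Z}) :
    W.trace.im = 0 := by
  have real : ∀ c : ℂ, c.im = 0 → ∀ W : Mat2, c • W = c.re • W := fun c hc W => by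
    rw [← Complex.coe_smul]
    congr 1
    exact Complex.ext rfl (by simpa using hc)
  have sq : ∀ U : Mat2, U.det = 1 → U.trace.im = 0 →
      U * U = U.trace.re • U + (-1 : ℝ) • 1 := fun U hU tU => by
    rw [mul_self_eq, hU, real _ tU]; module
  have sw : ∀ U V : Mat2, U.trace.im = 0 → V.trace.im = 0 → (U * V).trace.im = 0 →
      V * U = -(U * V) + V.trace.re • U + U.trace.re • V
        + ((U * V).trace - U.trace * V.trace).re • 1 := fun U V tU tV tUV => by
    rw [mul_add_mul_swap U V, real _ tV, real _ tU, real _ (by simp [tUV, tU, tV])]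
  have h := adjoin_le_span_monomials (sq X hX tX) (sq Y hY tY) (sq Z hZ tZ) (sw X Y tX tY tXY)
    (sw X Z tX tZ tXZ) (sw Y Z tY tZ tYZ) hW
  clear hW
  induction h using Submodule.span_induction with
  | zero => simp
  | add u v _ _ hu hv => rw [Matrix.trace_add, Complex.add_im, hu, hv, add_zero]
  | smul c u _ hu => rw [Matrix.trace_smul, Complex.smul_im, hu, smul_zero]
  | mem w hw => rcases hw with rfl | rfl | rfl | rfl | rfl | rfl | rfl | rfl <;> first | assumption | simp

/-- The conjugate transpose of the adjugate. -/
def conjAdj (X : Mat2) : Mat2 := X.adjugateᴴ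

/-- The adjugate is linear in size two, so `conjAdj` extends `X ↦ (Xᴴ)⁻¹` from unimodular matrices
to a ring endomorphism of `Mat2`. -/
theorem conjAdj_add (X Y : Mat2) : conjAdj (X + Y) = conjAdj X + conjAdj Y := by
  rw [conjAdj, adjugate_add_two, Matrix.conjTranspose_add]; rfl

theorem conjAdj_mul (X Y : Mat2) : conjAdj (X * Y) = conjAdj X * conjAdj Y := by
  rw [conjAdj, Matrix.adjugate_mul_distrib, Matrix.conjTranspose_mul]; rfl

theorem conjAdj_real_smul (c : ℝ) (X : Mat2) : conjAdj (c • X) = c • conjAdj X := by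
  simp only [conjAdj, adjugate_eq, Matrix.trace_smul, Matrix.conjTranspose_sub,
    Matrix.conjTranspose_smul, Matrix.conjTranspose_one]
  ext i j
  simp
  ring

theorem conjAdj_one : conjAdj 1 = 1 := by simp [conjAdj]

theorem conjTranspose_mul_conjAdj (X : Mat2) (hX : X.det = 1) : Xᴴ * conjAdj X = 1 := by
  rw [conjAdj, ← Matrix.conjTranspose_mul, Matrix.adjugate_mul, hX]; simp

theorem conjAdj_mul_conjTranspose (X : Mat2) (hX : X.det = 1) : conjAdj X * Xᴴ = 1 := by
  rw [conjAdj, ← Matrix.conjTranspose_mul, Matrix.mul_adjugate, hX]; simp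

/-- The right-hand condition is real-linear in `X`, so it makes sense on a whole real algebra. -/
theorem conjTranspose_mul_mul_iff {X H : Mat2} (hX : X.det = 1) :
    Xᴴ * H * X = H ↔ H * X = conjAdj X * H := by
  constructor
  · intro h
    calc H * X = conjAdj X * Xᴴ * H * X := by rw [conjAdj_mul_conjTranspose X hX, one_mul]
      _ = _ := by rw [mul_assoc, mul_assoc, ← mul_assoc Xᴴ, h]
  · intro h
    rw [mul_assoc, h, ← mul_assoc, conjTranspose_mul_conjAdj X hX, one_mul]

variable {A : Subalgebra ℝ Mat2}

/-- Since `Mat2 = A ⊕ iA`, `conjAdj` on `A` has a complex linear extension `L`, although `conjAdj`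
itself is conjugate-linear. `H` is then the averaged intertwiner of the Skolem–Noether theorem,
built from matrix units. -/
theorem exists_intertwiner (hspan : Submodule.span ℂ (A : Set Mat2) = ⊤) (hA : IsTotallyReal A) :
    ∃ H : Mat2, H ≠ 0 ∧ ∀ X ∈ A, H * X = conjAdj X * H := by
  choose P hP Q hQ hPQ using exists_add_I_smul hspan
  have uniq : ∀ Y ∈ A, ∀ Z ∈ A, P (Y + Complex.I • Z) = Y ∧ Q (Y + Complex.I • Z) = Z := by
    intro Y hY Z hZ
    have h := hPQ (Y + Complex.I • Z)
    have h1 : Complex.I • (Z - Q (Y + Complex.I • Z)) = P (Y + Complex.I • Z) - Y := by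
      rw [smul_sub, sub_eq_sub_iff_add_eq_add, add_comm, ← h, add_comm]
    have h2 := hA _ (A.sub_mem hZ (hQ _)) (h1 ▸ A.sub_mem (hP _) hY)
    rw [h2, smul_zero] at h1
    exact ⟨(sub_eq_zero.1 h1.symm), (sub_eq_zero.1 h2).symm⟩
  let L : Mat2 → Mat2 := fun X => conjAdj (P X) + Complex.I • conjAdj (Q X)
  have hL : ∀ Y ∈ A, ∀ Z ∈ A, L (Y + Complex.I • Z) = conjAdj Y + Complex.I • conjAdj Z :=
    fun Y hY Z hZ => by simp only [L, (uniq Y hY Z hZ).1, (uniq Y hY Z hZ).2]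
  have hLA : ∀ Y ∈ A, L Y = conjAdj Y := fun Y hY => by
    have := hL Y hY 0 A.zero_mem
    simpa [conjAdj] using this
  have hLadd : ∀ X Y, L (X + Y) = L X + L Y := fun X Y => by
    conv_lhs => rw [hPQ X, hPQ Y]
    rw [show P X + Complex.I • Q X + (P Y + Complex.I • Q Y) = (P X + P Y) + Complex.I • (Q X + Q Y)
      by module, hL _ (A.add_mem (hP _) (hP _)) _ (A.add_mem (hQ _) (hQ _)), conjAdj_add, conjAdj_add]
    simp only [L]
    module
  have hLmul : ∀ X ∈ A, ∀ Y, L (X * Y) = conjAdj X * L Y := fun X hX Y => by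
    conv_lhs => rw [hPQ Y]
    rw [mul_add, Matrix.mul_smul, hL _ (A.mul_mem hX (hP _)) _ (A.mul_mem hX (hQ _)), conjAdj_mul,
      conjAdj_mul]
    simp only [L]
    rw [mul_add, Matrix.mul_smul]
  have hLreal : ∀ (c : ℝ) X, L (c • X) = c • L X := fun c X => by
    have := hLmul (c • 1) (A.smul_mem A.one_mem c) X
    rwa [conjAdj_real_smul, conjAdj_one, Matrix.smul_mul, one_mul, Matrix.smul_mul, one_mul] at this
  have hLI : ∀ X, L (Complex.I • X) = Complex.I • L X := fun X => by
    conv_lhs => rw [hPQ X]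
    rw [show Complex.I • (P X + Complex.I • Q X) = -Q X + Complex.I • P X by
      rw [smul_add, smul_smul, Complex.I_mul_I]; module,
      hL _ (A.neg_mem (hQ _)) _ (hP _)]
    have : conjAdj (-Q X) = -conjAdj (Q X) := by
      have := conjAdj_real_smul (-1) (Q X)
      simpa using this
    simp only [L]
    rw [this, smul_add, smul_smul, Complex.I_mul_I]
    module
  have hLsmul : ∀ (c : ℂ) X, L (c • X) = c • L X := fun c X => by
    have e : ∀ Y : Mat2, c • Y = c.re • Y + Complex.I • (c.im • Y) := fun Y => by
      ext i j
      simp only [Matrix.smul_apply, Matrix.add_apply, Complex.real_smul, smul_eq_mul]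
      linear_combination -(Y i j) * Complex.re_add_im c
    rw [e, hLadd, hLI, hLreal, hLreal, e (L X)]
  have hE : L (Matrix.single 0 0 1) ≠ 0 ∨ L (Matrix.single 1 1 1) ≠ 0 := by
    by_contra! h
    have h1 : (1 : Mat2) = Matrix.single 0 0 1 + Matrix.single 1 1 1 := by
      ext i j; fin_cases i <;> fin_cases j <;> simp
    have := hLA 1 A.one_mem
    rw [conjAdj_one, h1, hLadd, h.1, h.2, add_zero] at this
    exact one_ne_zero (h1.trans this.symm)
  obtain ⟨k, hk⟩ : ∃ k : Fin 2, L (Matrix.single k k 1) ≠ 0 := hE.elim (⟨0, ·⟩) (⟨1, ·⟩)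
  obtain ⟨i, j, hij⟩ : ∃ i j, L (Matrix.single k k 1) i j ≠ 0 := by
    by_contra! h
    exact hk (Matrix.ext h)
  -- With this `C`, the entry `H i k` equals `L (E_kk) i j`, which is nonzero by the choice of `i`,
  -- `j`, `k`.
  let C : Mat2 := Matrix.single j k 1
  let H : Mat2 := ∑ m, L (Matrix.single m k 1) * C * Matrix.single k m 1
  refine ⟨H, fun h0 => hij ?_, fun X hX => ?_⟩
  · have := congrFun (congrFun h0 i) k
    simp only [H, Matrix.sum_apply] at this
    rw [Finset.sum_eq_single k] at this
    · obtain rfl | rfl : j = 0 ∨ j = 1 := by fin_cases j <;> simp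
      · simpa [C, Matrix.mul_apply, Matrix.single_apply] using this
      · simpa [C, Matrix.mul_apply, Matrix.single_apply] using this
    · intro m _ hm
      simp [Matrix.mul_apply, hm]
    · simp
  · simp only [H, Finset.sum_mul, Finset.mul_sum]
    -- Expanding in matrix units, both sides become the sum of `X n m • (L (E_nk) * C * E_km)` over
    -- `m` and `n`.
    have h1 : ∀ m, Matrix.single k m (1 : ℂ) * X = ∑ n, X m n • Matrix.single k n (1 : ℂ) := fun m => by
      ext a b; fin_cases a <;> fin_cases b <;> fin_cases k <;> simp [Matrix.mul_apply, Matrix.single_apply]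
    have h2 : ∀ m, X * Matrix.single m k (1 : ℂ) = ∑ n, X n m • Matrix.single n k (1 : ℂ) := fun m => by
      ext a b; fin_cases a <;> fin_cases b <;> fin_cases k <;> simp [Matrix.mul_apply, Matrix.single_apply]
    simp only [← mul_assoc, ← hLmul X hX, h2, Fin.sum_univ_two, hLadd, hLsmul]
    simp only [mul_assoc, h1, Fin.sum_univ_two, mul_add, add_mul, Matrix.smul_mul, Matrix.mul_smul]
    abel

/-- An irreducible real algebra with real traces preserves a nondegenerate Hermitian form. -/
theorem exists_hermitian (hirr : NoCommonEigenvector (A : Set Mat2)) (hA : IsTotallyReal A) :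
    ∃ H : Mat2, H.IsHermitian ∧ H.det ≠ 0 ∧ ∀ X ∈ A, X.det = 1 → Xᴴ * H * X = H := by
  have hspan := span_eq_top_of_noCommonEigenvector hirr
  obtain ⟨H₀, hH₀, hint⟩ := exists_intertwiner hspan hA
  have hadj : ∀ X ∈ A, X.adjugate ∈ A := fun X hX => by
    have : X.adjugate = X.trace.re • (1 : Mat2) - X := by
      rw [adjugate_eq, ← Complex.coe_smul]
      congr 2
      exact Complex.ext rfl (by simpa using hA.trace_im hX)
    rw [this]
    exact A.sub_mem (A.smul_mem A.one_mem _) hX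
  have hint' : ∀ X ∈ A, H₀ᴴ * X = conjAdj X * H₀ᴴ := fun X hX => by
    have := congrArg Matrix.conjTranspose (hint _ (hadj X hX))
    rw [Matrix.conjTranspose_mul, Matrix.conjTranspose_mul, conjAdj, Matrix.conjTranspose_conjTranspose,
      Matrix.adjugate_adjugate _ (by simp)] at this
    simpa [conjAdj] using this.symm
  -- The kernel of an intertwiner is invariant under `A`; were it a line, it would be a common
  -- eigenline.
  have nondeg : ∀ H : Mat2, H ≠ 0 → (∀ X ∈ A, H * X = conjAdj X * H) → H.det ≠ 0 := by
    intro H hH hint hdet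
    obtain ⟨v, hv, hHv⟩ := Matrix.exists_mulVec_eq_zero_iff.2 hdet
    obtain ⟨X, hX, hXv⟩ := hirr v hv
    obtain ⟨c, hc⟩ := exists_smul_of_mulVec_eq_zero hH hv hHv
      (w := X *ᵥ v) (by rw [Matrix.mulVec_mulVec, hint X hX, ← Matrix.mulVec_mulVec, hHv, Matrix.mulVec_zero])
    exact hXv c hc
  have final : ∀ H : Mat2, H ≠ 0 → H.IsHermitian → (∀ X ∈ A, H * X = conjAdj X * H) →
      ∃ H : Mat2, H.IsHermitian ∧ H.det ≠ 0 ∧ ∀ X ∈ A, X.det = 1 → Xᴴ * H * X = H :=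
    fun H h0 hH hint => ⟨H, hH, nondeg H h0 hint, fun X hX hd =>
      (conjTranspose_mul_mul_iff hd).2 (hint X hX)⟩
  -- Intertwiners are closed under `ᴴ`. The Hermitian part works unless `H₀` is skew-Hermitian, and
  -- then `i H₀` is Hermitian.
  by_cases hs : H₀ + H₀ᴴ = 0
  · refine final (Complex.I • H₀) (smul_ne_zero Complex.I_ne_zero hH₀) ?_ fun X hX => ?_
    · rw [Matrix.IsHermitian, Matrix.conjTranspose_smul, eq_neg_of_add_eq_zero_right hs]
      simp
    · rw [Matrix.smul_mul, hint X hX, Matrix.mul_smul]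
  · refine final (H₀ + H₀ᴴ) hs ?_ fun X hX => ?_
    · rw [Matrix.IsHermitian, Matrix.conjTranspose_add, Matrix.conjTranspose_conjTranspose, add_comm]
    · rw [add_mul, hint X hX, hint' X hX, mul_add]

/-- Unimodular isometries of a nondegenerate form have real traces. -/
theorem trace_im_eq_zero_of_isometry {H X : Mat2} (hH : H.det ≠ 0) (hX : X.det = 1)
    (h : Xᴴ * H * X = H) : X.trace.im = 0 := by
  have hu := isUnit_iff_ne_zero.2 hH
  have h1 := (trace_det_of_transport (M := Xᵀ) hH
    (show conjAdj X * H = H * Xᵀᵀ by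
      rw [Matrix.transpose_transpose]; exact ((conjTranspose_mul_mul_iff hX).1 h).symm)).1
  rw [Matrix.trace_transpose, conjAdj, Matrix.trace_conjTranspose, adjugate_eq, Matrix.trace_sub,
    Matrix.trace_smul, Matrix.trace_one] at h1
  have := congrArg Complex.im h1
  simp at this
  linarith

end Hermitian

/-! ### The criterion for triples with prescribed exponents. -/

section UnitaryCriterion

open Matrix

/-- The trace and determinant of `M` are those of a matrix with eigenvalues `e^{2πiu}`, `e^{2πiv}`. -/
def HasExponents (M : Mat2) (u v : ℂ) : Prop :=
  M.trace = Complex.exp (2 * Real.pi * Complex.I * u) + Complex.exp (2 * Real.pi * Complex.I * v) ∧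
  M.det = Complex.exp (2 * Real.pi * Complex.I * u) * Complex.exp (2 * Real.pi * Complex.I * v)

theorem HasExponents.eigenvalue {M : Mat2} {u v : ℂ} (h : HasExponents M u v) {w : Fin 2 → ℂ}
    (hw : w ≠ 0) {x : ℂ} (hx : M *ᵥ w = x • w) :
    x = Complex.exp (2 * Real.pi * Complex.I * u) ∨ x = Complex.exp (2 * Real.pi * Complex.I * v) := by
  have h1 := congrArg (· *ᵥ w) (mul_self_eq M)
  simp only [← Matrix.mulVec_mulVec, hx, Matrix.mulVec_smul, Matrix.sub_mulVec, Matrix.smul_mulVec,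
    Matrix.one_mulVec, h.1, h.2] at h1
  set a := Complex.exp (2 * Real.pi * Complex.I * u)
  set b := Complex.exp (2 * Real.pi * Complex.I * v)
  have h2 : ((x - a) * (x - b)) • w = 0 := by
    have : (x * x - ((a + b) * x - a * b)) • w = 0 := by
      rw [sub_smul, mul_smul, h1]
      module
    rw [← this]
    congr 1
    ring
  rcases mul_eq_zero.1 ((smul_eq_zero.1 h2).resolve_right hw) with h | h
  · exact Or.inl (sub_eq_zero.1 h)
  · exact Or.inr (sub_eq_zero.1 h)

/-- A local exponent pair `0, 1 - c` gives the eigenvalues `1` and `e^{-2πic}`. -/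
theorem HasExponents.eigenvalue_local {M : Mat2} {c : ℂ} (h : HasExponents M 0 (1 - c))
    {w : Fin 2 → ℂ} (hw : w ≠ 0) {x : ℂ} (hx : M *ᵥ w = x • w) :
    ∃ s, (s = 0 ∨ s = c) ∧ x = Complex.exp (2 * Real.pi * Complex.I * -s) := by
  rcases h.eigenvalue hw hx with h | h
  · exact ⟨0, Or.inl rfl, by rw [h, neg_zero]⟩
  · refine ⟨c, Or.inr rfl, ?_⟩
    rw [h, show 2 * (Real.pi : ℂ) * Complex.I * (1 - c)
      = 2 * Real.pi * Complex.I + 2 * Real.pi * Complex.I * -c by ring, Complex.exp_add,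
      Complex.exp_two_pi_mul_I, one_mul]

/-- The reason for the factor `e^{πic}`: its square cancels the determinant `e^{-2πic}`. -/
theorem HasExponents.det_smul {M : Mat2} {c : ℂ} (h : HasExponents M 0 (1 - c)) :
    (Complex.exp (Real.pi * Complex.I * c) • M).det = 1 := by
  rw [Matrix.det_smul, h.2, Fintype.card_fin, ← Complex.exp_nat_mul, ← Complex.exp_add,
    ← Complex.exp_add, Complex.exp_eq_one_iff]
  exact ⟨1, by push_cast; ring⟩

theorem HasExponents.trace_smul {M : Mat2} {c : ℂ} (h : HasExponents M 0 (1 - c)) :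
    (Complex.exp (Real.pi * Complex.I * c) • M).trace = 2 * Complex.cos (Real.pi * c) := by
  rw [Matrix.trace_smul, h.1, Complex.cos, smul_eq_mul, mul_add, ← Complex.exp_add, ← Complex.exp_add,
    mul_div_cancel₀ _ two_ne_zero]
  congr 1
  · congr 1; ring
  · rw [show (Real.pi : ℂ) * Complex.I * c + 2 * Real.pi * Complex.I * (1 - c)
      = -(Real.pi * c) * Complex.I + 2 * Real.pi * Complex.I by ring, Complex.exp_add,
      Complex.exp_two_pi_mul_I, mul_one]

theorem exp_two_pi_eq_iff {s t : ℂ} : Complex.exp (2 * Real.pi * Complex.I * s) =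
    Complex.exp (2 * Real.pi * Complex.I * t) ↔ ∃ n : ℤ, s = t + n := by
  rw [Complex.exp_eq_exp_iff_exists_int]
  refine exists_congr fun n => ?_
  have h : (2 * Real.pi * Complex.I : ℂ) ≠ 0 := Complex.two_pi_I_ne_zero
  rw [show 2 * (Real.pi : ℂ) * Complex.I * t + n * (2 * Real.pi * Complex.I)
    = 2 * Real.pi * Complex.I * (t + n) by ring, mul_right_inj' h]

variable {α β γ δ ε : ℂ}

/-- On a common eigenvector the product has eigenvalue `e^{-2πi(s₁+s₂+s₃)}` with each `sⱼ` zero or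
the local parameter. So this sum is congruent modulo `1` to `α` or to `β`; in the second case Fuchs'
relation makes `α` congruent to the complementary sum. -/
theorem no_common_eigenvector (hFuchs : γ + δ + ε = 1 + α + β)
    (hirr : ¬ HeunReducibleCongruence α γ δ ε) {P Q R M : Mat2}
    (hP : HasExponents P 0 (1 - γ)) (hQ : HasExponents Q 0 (1 - δ)) (hR : HasExponents R 0 (1 - ε))
    (hM : HasExponents M (-α) (-β)) (hprod : M = P * Q * R ∨ M = P * R * Q)
    {v : Fin 2 → ℂ} (hv : v ≠ 0) {x y z : ℂ} (hx : P *ᵥ v = x • v) (hy : Q *ᵥ v = y • v)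
    (hz : R *ᵥ v = z • v) : False := by
  have key : ∀ s₁ s₂ s₃, (s₁ = 0 ∨ s₁ = γ) → (s₂ = 0 ∨ s₂ = δ) → (s₃ = 0 ∨ s₃ = ε) → ∀ n : ℤ,
      α ≠ s₁ + s₂ + s₃ + n := by
    rintro _ _ _ (rfl | rfl) (rfl | rfl) (rfl | rfl) n h <;> exact hirr ⟨_, by simp, n, h⟩
  have hMv : M *ᵥ v = (x * y * z) • v := by
    rcases hprod with rfl | rfl
    · simp only [← Matrix.mulVec_mulVec, hx, hy, hz, Matrix.mulVec_smul, smul_smul]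
      congr 1; ring
    · simp only [← Matrix.mulVec_mulVec, hx, hy, hz, Matrix.mulVec_smul, smul_smul]
      congr 1; ring
  obtain ⟨s₁, h₁, rfl⟩ := hP.eigenvalue_local hv hx
  obtain ⟨s₂, h₂, rfl⟩ := hQ.eigenvalue_local hv hy
  obtain ⟨s₃, h₃, rfl⟩ := hR.eigenvalue_local hv hz
  rw [← Complex.exp_add, ← Complex.exp_add, ← mul_add, ← mul_add] at hMv
  rcases hM.eigenvalue hv hMv with h | h
  · obtain ⟨n, hn⟩ := exp_two_pi_eq_iff.1 h
    exact key s₁ s₂ s₃ h₁ h₂ h₃ n (by linear_combination hn)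
  · obtain ⟨n, hn⟩ := exp_two_pi_eq_iff.1 h
    have compl : ∀ s c : ℂ, (s = 0 ∨ s = c) → (c - s = 0 ∨ c - s = c) := by
      rintro s c (rfl | rfl) <;> simp
    refine key _ _ _ (compl _ _ h₁) (compl _ _ h₂) (compl _ _ h₃) (-1 - n) ?_
    push_cast
    linear_combination -hFuchs - hn

theorem cos_im_eq_zero_of_im_eq_zero {c : ℂ} (hc : c.im = 0) : (Complex.cos (Real.pi * c)).im = 0 := by
  lift c to ℝ using hc
  rw [← Complex.ofReal_mul, ← Complex.ofReal_cos, Complex.ofReal_im]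

/-- With real `γ + δ + ε`, the condition on `α`, `β` says that `cos π(α - β)` is real. -/
theorem exponents_at_infinity_real_iff (hFuchs : γ + δ + ε = 1 + α + β) (hγ : γ.im = 0)
    (hδ : δ.im = 0) (hε : ε.im = 0) :
    ((α.im = 0 ∧ β.im = 0) ∨ ∃ n : ℤ, α - (starRingEnd ℂ) β = n) ↔
      (Complex.cos (Real.pi * (α - β))).im = 0 := by
  have him : α.im + β.im = 0 := by
    have := congrArg Complex.im hFuchs
    simp [hγ, hδ, hε] at this
    linarith
  have hcos : (Complex.cos (Real.pi * (α - β))).im =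
      -(Real.sin (Real.pi * (α.re - β.re)) * Real.sinh (Real.pi * (α.im - β.im))) := by
    have hre : ((Real.pi : ℂ) * (α - β)).re = Real.pi * (α.re - β.re) := by simp
    have him' : ((Real.pi : ℂ) * (α - β)).im = Real.pi * (α.im - β.im) := by simp
    rw [Complex.cos_eq, hre, him', ← Complex.ofReal_cos, ← Complex.ofReal_sin, ← Complex.ofReal_cosh,
      ← Complex.ofReal_sinh]
    simp only [Complex.sub_im, Complex.mul_im, Complex.mul_re, Complex.ofReal_re, Complex.ofReal_im,
      Complex.I_re, Complex.I_im]
    ring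
  -- Since `Im α = -Im β`, the `sinh` factor vanishes exactly for real `α`, `β`, and the `sin`
  -- factor exactly when `α - conj β`, which is real, is an integer.
  rw [hcos, neg_eq_zero, mul_eq_zero, Real.sinh_eq_zero, Real.sin_eq_zero_iff, or_comm]
  refine or_congr ?_ ?_
  · constructor
    · rintro ⟨n, hn⟩
      refine ⟨n, ?_⟩
      have := congrArg Complex.re hn
      simp at this
      rw [this, mul_comm]
    · rintro ⟨n, hn⟩
      refine ⟨n, ?_⟩
      have h1 : α.re - β.re = n := by
        rw [mul_comm] at hn
        exact (mul_left_cancel₀ Real.pi_ne_zero hn).symm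
      apply Complex.ext <;> simp [h1, him]
  · rw [mul_eq_zero, or_iff_right Real.pi_ne_zero]
    constructor
    · rintro ⟨h1, h2⟩; rw [h1, h2, sub_zero]
    · intro h; constructor <;> linarith

theorem norm_exp_pi_eq_one_iff {c : ℂ} : ‖Complex.exp (Real.pi * Complex.I * c)‖ = 1 ↔ c.im = 0 := by
  rw [Complex.norm_exp, Real.exp_eq_one_iff]
  simp [Real.pi_ne_zero]

/-- An isometry has `|det P| = 1`, and `(e^{πic})² det P = 1`; hence `|e^{πic}| = 1`, which means
that `c` is real. -/
theorem im_eq_zero_of_isometry {P H : Mat2} {c : ℂ} (hP : HasExponents P 0 (1 - c)) (hH : H.det ≠ 0)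
    (h : Pᴴ * H * P = H) : c.im = 0 := by
  have h1 := congrArg Matrix.det h
  rw [Matrix.det_mul, Matrix.det_mul, Matrix.det_conjTranspose] at h1
  have h2 : ‖P.det‖ = 1 := by
    have h3 : star P.det * P.det = 1 := by
      apply mul_right_cancel₀ hH
      linear_combination h1
    have := congrArg norm h3
    rw [norm_mul, norm_star, norm_one] at this
    nlinarith [norm_nonneg P.det]
  have h4 := hP.det_smul
  rw [Matrix.det_smul, Fintype.card_fin] at h4
  have h5 := congrArg norm h4
  rw [norm_mul, h2, norm_pow, norm_one, mul_one] at h5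
  exact norm_exp_pi_eq_one_iff.1 ((pow_eq_one_iff_of_nonneg (norm_nonneg _) two_ne_zero).1 h5)

theorem isometry_smul_iff {P H : Mat2} {x : ℂ} (hx : ‖x‖ = 1) :
    (x • P)ᴴ * H * (x • P) = H ↔ Pᴴ * H * P = H := by
  have : (x • P)ᴴ * H * (x • P) = Pᴴ * H * P := by
    have h1 : x * star x = 1 := by
      rw [← starRingEnd_apply, Complex.mul_conj, Complex.normSq_eq_norm_sq, hx]; simp
    rw [Matrix.conjTranspose_smul, Matrix.smul_mul, Matrix.smul_mul, Matrix.mul_smul, smul_smul,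
      mul_comm, h1, one_smul]
  rw [this]

/-- Real pair traces of an irreducible unimodular triple with real local traces amount to the
generated real algebra being a real form of the matrix algebra. -/
theorem isTotallyReal_adjoin_iff {X Y Z : Mat2} (hX : X.det = 1) (hY : Y.det = 1)
    (hZ : Z.det = 1) (tX : X.trace.im = 0) (tY : Y.trace.im = 0) (tZ : Z.trace.im = 0)
    (tXYZ : (X * Y * Z).trace.im = 0 ∨ (X * Z * Y).trace.im = 0)
    (hspan : Submodule.span ℂ (Algebra.adjoin ℝ {X, Y, Z} : Set Mat2) = ⊤) :
    IsTotallyReal (Algebra.adjoin ℝ {X, Y, Z}) ↔ PairTracesReal X Y Z := by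
  have mX : X ∈ Algebra.adjoin ℝ {X, Y, Z} := Algebra.subset_adjoin (by simp)
  have mY : Y ∈ Algebra.adjoin ℝ {X, Y, Z} := Algebra.subset_adjoin (by simp)
  have mZ : Z ∈ Algebra.adjoin ℝ {X, Y, Z} := Algebra.subset_adjoin (by simp)
  constructor
  · intro h
    exact ⟨h.trace_im (mul_mem mX mY), h.trace_im (mul_mem mY mZ), h.trace_im (mul_mem mX mZ)⟩
  · rintro ⟨tXY, tYZ, tXZ⟩
    refine isTotallyReal_of_trace hspan fun W hW =>
      trace_im_eq_zero_of_mem_adjoin hX hY hZ tX tY tZ tXY tYZ tXZ ?_ hW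
    rw [← mul_assoc]
    rcases tXYZ with h | h
    · exact h
    · have := congrArg Complex.im (trace_mul_mul_add X Y Z)
      simpa [h, tX, tY, tZ, tXY, tYZ, tXZ] using this

/-- The unitarity criterion in terms of generators. -/
theorem unitary_criterion (hFuchs : γ + δ + ε = 1 + α + β)
    (hirr : ¬ HeunReducibleCongruence α γ δ ε) {P Q R M : Mat2}
    (hP : HasExponents P 0 (1 - γ)) (hQ : HasExponents Q 0 (1 - δ)) (hR : HasExponents R 0 (1 - ε))
    (hM : HasExponents M (-α) (-β)) (hprod : M = P * Q * R ∨ M = P * R * Q) {X Y Z : Mat2}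
    (hX : X = Complex.exp (Real.pi * Complex.I * γ) • P)
    (hY : Y = Complex.exp (Real.pi * Complex.I * δ) • Q)
    (hZ : Z = Complex.exp (Real.pi * Complex.I * ε) • R) :
    ((∃ H : Mat2, H.IsHermitian ∧ H.det ≠ 0 ∧ Pᴴ * H * P = H ∧ Qᴴ * H * Q = H ∧ Rᴴ * H * R = H) ↔
      HeunParameterCondition α β γ δ ε ∧ PairTracesReal X Y Z) ∧
    (HeunParameterCondition α β γ δ ε → (PairTracesReal X Y Z ↔
      Module.finrank ℝ (Algebra.adjoin ℝ ({X, Y, Z} : Set Mat2)) = 4)) := by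
  have dX : X.det = 1 := hX ▸ hP.det_smul
  have dY : Y.det = 1 := hY ▸ hQ.det_smul
  have dZ : Z.det = 1 := hZ ▸ hR.det_smul
  have tX : X.trace = 2 * Complex.cos (Real.pi * γ) := hX ▸ hP.trace_smul
  have tY : Y.trace = 2 * Complex.cos (Real.pi * δ) := hY ▸ hQ.trace_smul
  have tZ : Z.trace = 2 * Complex.cos (Real.pi * ε) := hZ ▸ hR.trace_smul
  have two_mul_im : ∀ w : ℂ, (2 * w).im = 0 ↔ w.im = 0 := fun w => by simp
  -- Fuchs' relation replaces `γ + δ + ε` by `1 + α + β`; the summand `1` produces the sign.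
  have tM : (Complex.exp (Real.pi * Complex.I * (γ + δ + ε)) • M).trace
      = -(2 * Complex.cos (Real.pi * (α - β))) := by
    rw [Matrix.trace_smul, hM.1, Complex.cos, smul_eq_mul, mul_add, ← Complex.exp_add,
      ← Complex.exp_add, mul_div_cancel₀ _ two_ne_zero, hFuchs,
      show (Real.pi : ℂ) * Complex.I * (1 + α + β) + 2 * Real.pi * Complex.I * -α
        = -(Real.pi * (α - β)) * Complex.I + Real.pi * Complex.I by ring,
      show (Real.pi : ℂ) * Complex.I * (1 + α + β) + 2 * Real.pi * Complex.I * -β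
        = Real.pi * (α - β) * Complex.I + Real.pi * Complex.I by ring, Complex.exp_add,
      Complex.exp_add, Complex.exp_pi_mul_I]
    ring
  have eM : Complex.exp (Real.pi * Complex.I * (γ + δ + ε)) • M = X * Y * Z ∨
      Complex.exp (Real.pi * Complex.I * (γ + δ + ε)) • M = X * Z * Y := by
    rw [hX, hY, hZ, mul_add, mul_add, Complex.exp_add, Complex.exp_add]
    refine hprod.imp ?_ ?_ <;> rintro rfl <;>
      simp only [Matrix.smul_mul, Matrix.mul_smul, smul_smul] <;> congr 1 <;> ring
  have triple : (Complex.cos (Real.pi * (α - β))).im = 0 →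
      (X * Y * Z).trace.im = 0 ∨ (X * Z * Y).trace.im = 0 := fun h => by
    have : (-(2 * Complex.cos (Real.pi * (α - β)))).im = 0 := by simp [h]
    rw [← tM] at this
    exact eM.imp (fun e => by rwa [← e]) (fun e => by rwa [← e])
  have irr : NoCommonEigenvector (Algebra.adjoin ℝ ({X, Y, Z} : Set Mat2) : Set Mat2) := by
    intro v hv
    by_contra! hcon
    have main : ∀ (c : ℂ) (N : Mat2), Complex.exp (Real.pi * Complex.I * c) • N
        ∈ Algebra.adjoin ℝ ({X, Y, Z} : Set Mat2) → ∃ x : ℂ, N *ᵥ v = x • v := fun c N hN => by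
      obtain ⟨x, hx⟩ := hcon _ hN
      refine ⟨(Complex.exp (Real.pi * Complex.I * c))⁻¹ * x, ?_⟩
      rw [mul_smul, ← hx, Matrix.smul_mulVec, smul_smul, inv_mul_cancel₀ (Complex.exp_ne_zero _),
        one_smul]
    obtain ⟨x, hx⟩ := main γ P (hX ▸ Algebra.subset_adjoin (by simp))
    obtain ⟨y, hy⟩ := main δ Q (hY ▸ Algebra.subset_adjoin (by simp))
    obtain ⟨z, hz⟩ := main ε R (hZ ▸ Algebra.subset_adjoin (by simp))
    exact no_common_eigenvector hFuchs hirr hP hQ hR hM hprod hv hx hy hz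
  have hspan := span_eq_top_of_noCommonEigenvector irr
  have real_iff : HeunParameterCondition α β γ δ ε →
      (IsTotallyReal (Algebra.adjoin ℝ {X, Y, Z}) ↔ PairTracesReal X Y Z) := by
    rintro ⟨⟨hγ, hδ, hε⟩, hαβ⟩
    refine isTotallyReal_adjoin_iff dX dY dZ ?_ ?_ ?_
      (triple ((exponents_at_infinity_real_iff hFuchs hγ hδ hε).1 hαβ)) hspan
    · rw [tX, two_mul_im]; exact cos_im_eq_zero_of_im_eq_zero hγ
    · rw [tY, two_mul_im]; exact cos_im_eq_zero_of_im_eq_zero hδ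
    · rw [tZ, two_mul_im]; exact cos_im_eq_zero_of_im_eq_zero hε
  refine ⟨⟨?_, ?_⟩, fun hc => (real_iff hc).symm.trans (finrank_eq_four_iff hspan).symm⟩
  · rintro ⟨H, -, hH, iP, iQ, iR⟩
    have hγ := im_eq_zero_of_isometry hP hH iP
    have hδ := im_eq_zero_of_isometry hQ hH iQ
    have hε := im_eq_zero_of_isometry hR hH iR
    have iX : Xᴴ * H * X = H := hX ▸ (isometry_smul_iff (norm_exp_pi_eq_one_iff.2 hγ)).2 iP
    have iY : Yᴴ * H * Y = H := hY ▸ (isometry_smul_iff (norm_exp_pi_eq_one_iff.2 hδ)).2 iQ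
    have iZ : Zᴴ * H * Z = H := hZ ▸ (isometry_smul_iff (norm_exp_pi_eq_one_iff.2 hε)).2 iR
    have imul : ∀ U V : Mat2, Uᴴ * H * U = H → Vᴴ * H * V = H → (U * V)ᴴ * H * (U * V) = H :=
      fun U V hU hV => by
        rw [Matrix.conjTranspose_mul]
        calc Vᴴ * Uᴴ * H * (U * V) = Vᴴ * (Uᴴ * H * U) * V := by simp only [mul_assoc]
          _ = H := by rw [hU, hV]
    have tr : ∀ U : Mat2, U.det = 1 → Uᴴ * H * U = H → U.trace.im = 0 := fun U hU h =>
      trace_im_eq_zero_of_isometry hH hU h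
    refine ⟨⟨⟨hγ, hδ, hε⟩, (exponents_at_infinity_real_iff hFuchs hγ hδ hε).2 ?_⟩,
      tr _ (by rw [Matrix.det_mul, dX, dY, one_mul]) (imul _ _ iX iY),
      tr _ (by rw [Matrix.det_mul, dY, dZ, one_mul]) (imul _ _ iY iZ),
      tr _ (by rw [Matrix.det_mul, dX, dZ, one_mul]) (imul _ _ iX iZ)⟩
    -- The rescaled triple product is itself a unimodular isometry; its real trace encodes the
    -- condition on `α`, `β`.
    have h3 : (Complex.exp (Real.pi * Complex.I * (γ + δ + ε)) • M).trace.im = 0 := by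
      rcases eM with e | e <;> rw [e]
      · exact tr _ (by simp [dX, dY, dZ]) (imul _ _ (imul _ _ iX iY) iZ)
      · exact tr _ (by simp [dX, dY, dZ]) (imul _ _ (imul _ _ iX iZ) iY)
    rw [tM] at h3
    simpa using h3
  · rintro ⟨hc, hpair⟩
    obtain ⟨H, hH, hdet, hiso⟩ := exists_hermitian irr ((real_iff hc).2 hpair)
    obtain ⟨⟨hγ, hδ, hε⟩, -⟩ := hc
    refine ⟨H, hH, hdet, ?_, ?_, ?_⟩
    · rw [← isometry_smul_iff (norm_exp_pi_eq_one_iff.2 hγ), ← hX]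
      exact hiso X (Algebra.subset_adjoin (by simp)) dX
    · rw [← isometry_smul_iff (norm_exp_pi_eq_one_iff.2 hδ), ← hY]
      exact hiso Y (Algebra.subset_adjoin (by simp)) dY
    · rw [← isometry_smul_iff (norm_exp_pi_eq_one_iff.2 hε), ← hZ]
      exact hiso Z (Algebra.subset_adjoin (by simp)) dZ

theorem isUnitaryGroup_closure_iff {ι : Type*} (M : ι → GL (Fin 2) ℂ) :
    IsUnitaryGroup (Subgroup.closure (Set.range M)) ↔ ∃ H : Mat2, H.IsHermitian ∧ H.det ≠ 0 ∧
      ∀ i, (M i : Mat2)ᴴ * H * (M i : Mat2) = H := by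
  constructor
  · rintro ⟨H, h1, h2, h3⟩
    exact ⟨H, h1, h2, fun i => h3 _ (Subgroup.subset_closure ⟨i, rfl⟩)⟩
  · rintro ⟨H, h1, h2, h3⟩
    refine ⟨H, h1, h2, fun g hg => ?_⟩
    induction hg using Subgroup.closure_induction with
    | mem g hg => obtain ⟨i, rfl⟩ := hg; exact h3 i
    | one => simp
    | mul g g' _ _ hg hg' =>
      rw [Units.val_mul, Matrix.conjTranspose_mul]
      calc (g' : Mat2)ᴴ * (g : Mat2)ᴴ * H * ((g : Mat2) * (g' : Mat2))
          = (g' : Mat2)ᴴ * ((g : Mat2)ᴴ * H * (g : Mat2)) * (g' : Mat2) := by simp only [mul_assoc]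
        _ = H := by rw [hg, hg']
    | inv g _ hg =>
      have e : (g : Mat2) * ((g⁻¹ : GL (Fin 2) ℂ) : Mat2) = 1 := by
        rw [← Units.val_mul, mul_inv_cancel, Units.val_one]
      calc ((g⁻¹ : GL (Fin 2) ℂ) : Mat2)ᴴ * H * ((g⁻¹ : GL (Fin 2) ℂ) : Mat2)
          = ((g⁻¹ : GL (Fin 2) ℂ) : Mat2)ᴴ * ((g : Mat2)ᴴ * H * (g : Mat2)) *
              ((g⁻¹ : GL (Fin 2) ℂ) : Mat2) := by rw [hg]
        _ = ((g : Mat2) * ((g⁻¹ : GL (Fin 2) ℂ) : Mat2))ᴴ * H *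
              ((g : Mat2) * ((g⁻¹ : GL (Fin 2) ℂ) : Mat2)) := by
            rw [Matrix.conjTranspose_mul]; simp only [mul_assoc]
        _ = H := by rw [e]; simp

end UnitaryCriterion

/-! ### Exponents of the Heun equation at its singular points. -/

section Heun

open Filter

attribute [local instance] Matrix.linftyOpNormedRing Matrix.linftyOpNormedAlgebra

variable {α β γ δ ε a B : ℂ}

theorem isOpen_compl_heunSing (a : ℂ) : IsOpen (heunSing a)ᶜ :=
  (Set.toFinite (heunSing a)).isClosed.isOpen_compl

theorem mem_compl_heunSing {z : ℂ} : z ∈ (heunSing a)ᶜ ↔ z ≠ 0 ∧ z - 1 ≠ 0 ∧ z - a ≠ 0 := by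
  simp [heunSing, sub_eq_zero]

theorem analyticOnNhd_heunP : AnalyticOnNhd ℂ (heunP γ δ ε a) (heunSing a)ᶜ := fun z hz => by
  obtain ⟨h0, h1, ha⟩ := mem_compl_heunSing.1 hz
  exact ((analyticAt_const.div analyticAt_id h0).add
    (analyticAt_const.div (analyticAt_id.sub analyticAt_const) h1)).add
    (analyticAt_const.div (analyticAt_id.sub analyticAt_const) ha)

theorem analyticOnNhd_heunQ : AnalyticOnNhd ℂ (heunQ α β a B) (heunSing a)ᶜ := fun z hz => by
  obtain ⟨h0, h1, ha⟩ := mem_compl_heunSing.1 hz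
  exact ((analyticAt_const.mul analyticAt_id).sub analyticAt_const).div
    ((analyticAt_id.mul (analyticAt_id.sub analyticAt_const)).mul
      (analyticAt_id.sub analyticAt_const)) (mul_ne_zero (mul_ne_zero h0 h1) ha)

theorem comap_norm_sub_nhdsGT_le (c : ℂ) :
    comap (fun z => ‖z - c‖) (𝓝[>] (0 : ℝ)) ≤ 𝓝[≠] c := by
  refine tendsto_id'.1 (tendsto_nhdsWithin_iff.2 ⟨?_, ?_⟩)
  · exact tendsto_iff_norm_sub_tendsto_zero.2 (tendsto_comap.mono_right nhdsWithin_le_nhds)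
  · filter_upwards [tendsto_comap.eventually self_mem_nhdsWithin] with z hz h
    rw [show z = c from h] at hz
    simp at hz

theorem tendsto_mul_of_simple_pole {p g : ℂ → ℂ} {A c : ℂ} (hp : ∀ z ≠ c, p z = A / (z - c) + g z)
    (hg : ContinuousAt g c) :
    Tendsto (fun z => (z - c) * p z) (comap (fun z => ‖z - c‖) (𝓝[>] (0 : ℝ))) (𝓝 A) := by
  refine Tendsto.mono_left ?_ (comap_norm_sub_nhdsGT_le c)
  have h : Tendsto (fun z => A + (z - c) * g z) (𝓝[≠] c) (𝓝 (A + (c - c) * g c)) :=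
    (ContinuousAt.add continuousAt_const
      ((continuousAt_id.sub continuousAt_const).mul hg)).tendsto.mono_left nhdsWithin_le_nhds
  rw [sub_self, zero_mul, add_zero] at h
  refine h.congr' ?_
  filter_upwards [self_mem_nhdsWithin] with z hz
  rw [hp z hz, mul_add, mul_div_cancel₀ _ (sub_ne_zero.2 hz)]

theorem tendsto_sq_mul_of_simple_pole {q g : ℂ → ℂ} {c : ℂ} (hq : ∀ z ≠ c, q z = g z / (z - c))
    (hg : ContinuousAt g c) :
    Tendsto (fun z => (z - c) ^ 2 * q z) (comap (fun z => ‖z - c‖) (𝓝[>] (0 : ℝ))) (𝓝 0) := by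
  refine Tendsto.mono_left ?_ (comap_norm_sub_nhdsGT_le c)
  have h : Tendsto (fun z => (z - c) * g z) (𝓝[≠] c) (𝓝 ((c - c) * g c)) :=
    ((continuousAt_id.sub continuousAt_const).mul hg).tendsto.mono_left nhdsWithin_le_nhds
  rw [sub_self, zero_mul] at h
  refine h.congr' ?_
  filter_upwards [self_mem_nhdsWithin] with z hz
  have := sub_ne_zero.2 hz
  rw [hq z hz]
  field_simp

theorem comap_norm_sub_atTop : comap (fun z : ℂ => ‖z - 0‖) atTop = Bornology.cobounded ℂ := by
  simp only [sub_zero, comap_norm_atTop]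

theorem tendsto_heunP_infinity :
    Tendsto (fun z => (z - 0) * heunP γ δ ε a z) (comap (fun z : ℂ => ‖z - 0‖) atTop)
      (𝓝 (γ + δ + ε)) := by
  rw [comap_norm_sub_atTop]
  have hinv : Tendsto (fun z : ℂ => z⁻¹) (Bornology.cobounded ℂ) (𝓝 0) := tendsto_inv₀_cobounded
  -- In the coordinate `w = 1 / z` the function extends continuously to `w = 0`.
  have hc : ContinuousAt (fun w : ℂ => γ + δ / (1 - w) + ε / (1 - a * w)) 0 := by
    refine ContinuousAt.add (ContinuousAt.add ?_ (ContinuousAt.div ?_ ?_ ?_))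
      (ContinuousAt.div ?_ ?_ ?_) <;> first | fun_prop | simp
  have h := hc.tendsto.comp hinv
  simp only [sub_zero, div_one, mul_zero] at h ⊢
  refine h.congr' ?_
  filter_upwards [Bornology.eventually_ne_cobounded (0 : ℂ)] with z hz
  have e : ∀ s : ℂ, z - s = z * (1 - s * z⁻¹) := fun s => by field_simp
  have e1 : ∀ A s : ℂ, z * (A / (z - s)) = A / (1 - s * z⁻¹) := fun A s => by
    rw [e, mul_div_assoc', mul_div_mul_left _ _ hz]
  simp only [Function.comp_apply, heunP]
  rw [mul_add, mul_add, e1, e1, mul_div_cancel₀ _ hz, one_mul]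

theorem tendsto_heunQ_infinity :
    Tendsto (fun z => (z - 0) ^ 2 * heunQ α β a B z) (comap (fun z : ℂ => ‖z - 0‖) atTop)
      (𝓝 (α * β)) := by
  rw [comap_norm_sub_atTop]
  have hinv : Tendsto (fun z : ℂ => z⁻¹) (Bornology.cobounded ℂ) (𝓝 0) := tendsto_inv₀_cobounded
  have hc : ContinuousAt (fun w : ℂ => (α * β - B / 4 * w) / ((1 - w) * (1 - a * w))) 0 := by
    refine ContinuousAt.div ?_ ?_ ?_ <;> first | fun_prop | simp
  have h := hc.tendsto.comp hinv
  simp only [sub_zero, div_one, mul_zero, mul_one] at h ⊢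
  refine h.congr' ?_
  filter_upwards [Bornology.eventually_ne_cobounded (0 : ℂ)] with z hz
  have e : ∀ s : ℂ, z - s = z * (1 - s * z⁻¹) := fun s => by field_simp
  simp only [Function.comp_apply, heunQ]
  rw [e 1, e a, one_mul, show z * (z * (1 - z⁻¹)) * (z * (1 - a * z⁻¹))
    = z ^ 3 * ((1 - z⁻¹) * (1 - a * z⁻¹)) by ring, show α * β * z - B / 4
    = z * (α * β - B / 4 * z⁻¹) by field_simp, mul_div_assoc', show z ^ 2 * (z * (α * β - B / 4 * z⁻¹))
    = z ^ 3 * (α * β - B / 4 * z⁻¹) by ring, mul_div_mul_left _ _ (pow_ne_zero 3 hz)]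

section Exponents

variable {b : ↥(heunSing a)ᶜ} {y : Fin 2 → ℂ → ℂ} {T : Mat2}

/-- Local monodromy at a finite singular point with exponents `0` and `1 - A`. -/
theorem hasExponents_of_isLoopAround {ℓ : Path b b} {c A : ℂ} {g h : ℂ → ℂ} (hℓ : IsLoopAround ℓ c)
    (hp : ∀ z ≠ c, heunP γ δ ε a z = A / (z - c) + g z) (hg : ContinuousAt g c)
    (hq : ∀ z ≠ c, heunQ α β a B z = h z / (z - c)) (hh : ContinuousAt h c)
    (hT : IsTransport (companion (heunP γ δ ε a) (heunQ α β a B)) (fun t => (ℓ t : ℂ)) T) :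
    HasExponents T 0 (1 - A) := by
  obtain ⟨r, hr, hrS, hhom⟩ := hℓ
  refine trace_det_of_freelyHomotopicToCircle (isOpen_compl_heunSing a) analyticOnNhd_heunP
    -- Shrinking the radius from `r` to `0` never meets another singular point.
    analyticOnNhd_heunQ hhom (l := 𝓝[>] (0 : ℝ)) (J := Set.Ioc 0 r) Set.ordConnected_Ioc
    (Ioc_mem_nhdsGT hr) ⟨hr, le_rfl⟩ (fun s hs => ⟨hs.1, fun z hz hzS => ?_⟩) ?_ ?_ hT
  · have hzc : z ≠ c := fun h => by
      rw [h, sub_self, norm_zero] at hz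
      exact hs.1.ne hz
    have := hrS z hzS hzc
    rw [dist_eq_norm, hz] at this
    exact absurd hs.2 (not_le.2 this)
  · simpa using tendsto_mul_of_simple_pole hp hg
  · simpa using tendsto_sq_mul_of_simple_pole hq hh

theorem hasExponents_of_isLoopAroundAll {ℓ : Path b b} (hFuchs : γ + δ + ε = 1 + α + β)
    (hℓ : IsLoopAroundAll ℓ)
    (hT : IsTransport (companion (heunP γ δ ε a) (heunQ α β a B)) (fun t => (ℓ t : ℂ)) T) :
    HasExponents T (-α) (-β) := by
  obtain ⟨r, hr, hrS, hhom⟩ := hℓ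
  refine trace_det_of_freelyHomotopicToCircle (isOpen_compl_heunSing a) analyticOnNhd_heunP
    analyticOnNhd_heunQ hhom (l := atTop) (J := Set.Ici r) Set.ordConnected_Ici
    (Ici_mem_atTop r) (Set.self_mem_Ici) (fun s hs => ⟨hr.trans_le hs, fun z hz hzS => ?_⟩) ?_ ?_ hT
  · have := hrS z hzS
    rw [sub_zero] at hz
    rw [hz] at this
    exact absurd hs (not_le.2 this)
  · rw [show 1 - -α - -β = γ + δ + ε by rw [hFuchs]; ring]
    exact tendsto_heunP_infinity
  · rw [neg_mul_neg]
    exact tendsto_heunQ_infinity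

theorem HasExponents.of_transport {W M : Mat2} {u v : ℂ} (hT : HasExponents T u v)
    (hW : W.det ≠ 0) (h : T * W = W * Mᵀ) : HasExponents M u v := by
  obtain ⟨h1, h2⟩ := trace_det_of_transport hW h
  exact ⟨h1.trans hT.1, h2.trans hT.2⟩

end Exponents

end Heun

/-! ### The criterion for the Heun equation. -/

theorem corollary2 (α β γ δ ε a B : ℂ) (ha0 : a ≠ 0) (ha1 : a ≠ 1)
    (hFuchs : γ + δ + ε = 1 + α + β)
    (hirr : ¬ HeunReducibleCongruence α γ δ ε)
    (b : ↥(heunSing a)ᶜ) (y : Fin 2 → ℂ → ℂ)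
    (hy : IsFundamentalSystem (heunP γ δ ε a) (heunQ α β a B) b y)
    (ℓ₀ ℓ₁ ℓₐ : Path b b) (hℓ : IsStandardLoopSystem a ℓ₀ ℓ₁ ℓₐ)
    (P Q R : GL (Fin 2) ℂ)
    (hP : IsMonodromyMatrix y ℓ₀ P) (hQ : IsMonodromyMatrix y ℓ₁ Q)
    (hR : IsMonodromyMatrix y ℓₐ R) :
    (IsUnitaryGroup (monodromyGroup b y) ↔
      HeunParameterCondition α β γ δ ε ∧
        PairTracesReal (rescale γ P) (rescale δ Q) (rescale ε R)) ∧
    (HeunParameterCondition α β γ δ ε →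
      (PairTracesReal (rescale γ P) (rescale δ Q) (rescale ε R) ↔
        Module.finrank ℝ (Algebra.adjoin ℝ
          ({rescale γ P, rescale δ Q, rescale ε R} : Set (Matrix (Fin 2) (Fin 2) ℂ))) = 4)) := by
  -- An auxiliary norm on matrices for the analytic lemmas; the statement does not involve it.
  let := Matrix.linftyOpNormedRing (n := Fin 2) (α := ℂ)
  let := Matrix.linftyOpNormedAlgebra (R := ℂ) (n := Fin 2) (α := ℂ)
  have hS := isOpen_compl_heunSing a
  have hp : AnalyticOnNhd ℂ (heunP γ δ ε a) (heunSing a)ᶜ := analyticOnNhd_heunP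
  have hq : AnalyticOnNhd ℂ (heunQ α β a B) (heunSing a)ᶜ := analyticOnNhd_heunQ
  have hA := differentiableOn_companion hp hq
  have hW := hy.det_cauchyData_ne_zero hS hp hq
  obtain ⟨T₀, hT₀⟩ := IsTransport.exists_transport hS hA (h := fun t => (ℓ₀ t : ℂ)) (by fun_prop)
    fun t => (ℓ₀ t).2
  obtain ⟨T₁, hT₁⟩ := IsTransport.exists_transport hS hA (h := fun t => (ℓ₁ t : ℂ)) (by fun_prop)
    fun t => (ℓ₁ t).2
  obtain ⟨Tₐ, hTₐ⟩ := IsTransport.exists_transport hS hA (h := fun t => (ℓₐ t : ℂ)) (by fun_prop)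
    fun t => (ℓₐ t).2
  have eP := hP.transport_mul hS hp hq hy hT₀
  have eQ := hQ.transport_mul hS hp hq hy hT₁
  have eR := hR.transport_mul hS hp hq hy hTₐ
  have ha1' : a - 1 ≠ 0 := sub_ne_zero.2 ha1
  have ha1'' : 1 - a ≠ 0 := sub_ne_zero.2 ha1.symm
  have xP : HasExponents (P : Mat2) 0 (1 - γ) := by
    refine (hasExponents_of_isLoopAround hℓ.around_zero (g := fun z => δ / (z - 1) + ε / (z - a))
      (h := fun z => (α * β * z - B / 4) / ((z - 1) * (z - a))) ?_ ?_ ?_ ?_ hT₀).of_transport hW eP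
    · intro z _; rw [heunP, sub_zero]; ring
    · refine ContinuousAt.add (ContinuousAt.div ?_ ?_ ?_) (ContinuousAt.div ?_ ?_ ?_) <;>
        first | fun_prop | simp [ha0]
    · intro z _; rw [heunQ, sub_zero, div_div]; congr 1; ring
    · refine ContinuousAt.div ?_ ?_ ?_ <;> first | fun_prop | simp [ha0]
  have xQ : HasExponents (Q : Mat2) 0 (1 - δ) := by
    refine (hasExponents_of_isLoopAround hℓ.around_one (g := fun z => γ / z + ε / (z - a))
      (h := fun z => (α * β * z - B / 4) / (z * (z - a))) ?_ ?_ ?_ ?_ hT₁).of_transport hW eQ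
    · intro z _; rw [heunP]; ring
    · refine ContinuousAt.add (ContinuousAt.div ?_ ?_ ?_) (ContinuousAt.div ?_ ?_ ?_) <;>
        first | fun_prop | simp [ha1'']
    · intro z _; rw [heunQ, div_div]; congr 1; ring
    · refine ContinuousAt.div ?_ ?_ ?_ <;> first | fun_prop | simp [ha1'']
  have xR : HasExponents (R : Mat2) 0 (1 - ε) := by
    refine (hasExponents_of_isLoopAround hℓ.around_a (g := fun z => γ / z + δ / (z - 1))
      (h := fun z => (α * β * z - B / 4) / (z * (z - 1))) ?_ ?_ ?_ ?_ hTₐ).of_transport hW eR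
    · intro z _; rw [heunP]; ring
    · refine ContinuousAt.add (ContinuousAt.div ?_ ?_ ?_) (ContinuousAt.div ?_ ?_ ?_) <;>
        first | fun_prop | simp [ha0, ha1']
    · intro z _; rw [heunQ, div_div]
    · refine ContinuousAt.div ?_ ?_ ?_ <;> first | fun_prop | simp [ha0, ha1']
  -- Transports compose in reverse order and the transpose reverses them again, so monodromy
  -- matrices multiply in the order in which the loops are traversed.
  have mulT : ∀ {T T' N N' : Mat2}, T * cauchyData y b = cauchyData y b * Nᵀ →
      T' * cauchyData y b = cauchyData y b * N'ᵀ →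
      T' * T * cauchyData y b = cauchyData y b * (N * N')ᵀ := fun h h' => by
    rw [mul_assoc, h, ← mul_assoc, h', Matrix.transpose_mul, mul_assoc]
  obtain ⟨M, hM, hprod⟩ : ∃ M : Mat2, HasExponents M (-α) (-β) ∧
      (M = (P : Mat2) * Q * R ∨ M = (P : Mat2) * R * Q) := by
    rcases hℓ.around_all with h | h
    · exact ⟨_, (hasExponents_of_isLoopAroundAll hFuchs h ((hT₀.trans hS hA hT₁).trans hS hA
        hTₐ)).of_transport hW (mulT (mulT eP eQ) eR), Or.inl rfl⟩
    · exact ⟨_, (hasExponents_of_isLoopAroundAll hFuchs h ((hT₀.trans hS hA hTₐ).trans hS hA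
        hT₁)).of_transport hW (mulT (mulT eP eR) eQ), Or.inr rfl⟩
  have hgroup : monodromyGroup b y = Subgroup.closure (Set.range ![P, Q, R]) := by
    refine monodromyGroup_eq_closure hS hp hq hy (ℓ := ![ℓ₀, ℓ₁, ℓₐ])
      (fun i => by fin_cases i <;> assumption) ?_
    rw [← hℓ.generate]
    congr 1
    ext g
    simp [Fin.exists_fin_succ, eq_comm]
  rw [hgroup, isUnitaryGroup_closure_iff]
  have := unitary_criterion hFuchs hirr xP xQ xR hM hprod (X := rescale γ P) (Y := rescale δ Q)
    (Z := rescale ε R) rfl rfl rfl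
  simpa only [Fin.forall_fin_succ, Matrix.cons_val_zero, Matrix.cons_val_succ, IsEmpty.forall_iff,
    and_true] using this
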